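/- Let $k$ be an infinite field, $S = k[[x,y]]$ the ring of formal power series in two variables and $\mathfrak m = (x,y)$ its maximal ideal. Let $f \in \mathfrak m$ be written as $f = f_1 \cdots f_n$ with irreducible $f_i \in \mathfrak m$, and assume that $R := S/(f)$ is reduced. For $1 \le i \le n$ put $S_i := S/(f_1 \cdots f_i)$, regarded as an $R$-module through the canonical surjection $R \to S_i$. Let $\operatorname{CM}(R)$ be the category of maximal Cohen--Macaulay $R$-modules, that is, of finitely generated $R$-modules that are zero or have depth $\dim R$. For a finitely generated module $M$, let $\operatorname{add} M$ be the class of modules isomorphic to direct summands of finite direct sums of copies of $M$. An object $M$ of $\operatorname{CM}(R)$ is called rigid if $\operatorname{Ext}^1_R(M,M)=0$, and cluster tilting if $$\operatorname{add} M = \{X \in \operatorname{CM}(R) \mid \operatorname{Ext}^1_R(M,X)=0\} = \{X \in \operatorname{CM}(R) \mid \operatorname{Ext}^1_R(X,M)=0\}.$$ Then: (a) $\bigoplus_{i=1}^n S_i$ is a rigid object in $\operatorname{CM}(R)$. (b) If $f_i \notin \mathfrak m^2$ for all $1 \le i \le n$, then $\bigoplus_{i=1}^n S_i$ is a cluster tilting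 object in $\operatorname{CM}(R)$. -/

import Mathlib

universe u

namespace CMCluster

section General

variable (R : Type u) [CommRing R] [IsLocalRing R]

/-- The objects of `CM(R)`, for a commutative noetherian local ring `R`: finitely generated modules
that are zero or of depth `dim R`. As the depth of a nonzero finitely generated module never exceeds
`dim R`, the latter says that there is a regular sequence of length `dim R` in the maximal ideal. -/
def IsMaximalCohenMacaulay (M : ModuleCat.{u} R) : Prop :=
  Module.Finite R M ∧
    (Subsingleton M ∨
      ∃ rs : List R, (∀ r ∈ rs, r ∈ IsLocalRing.maximalIdeal R) ∧
        RingTheory.Sequence.IsRegular M rs ∧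
        ((rs.length : ℕ) : WithBot ℕ∞) = ringKrullDim R)

variable {R}

/-- `X ∈ add M`: `X` is isomorphic to a direct summand of a finite direct sum of copies of `M`. -/
def InAdd {A : Type u} [CommRing A] (M X : ModuleCat.{u} A) : Prop :=
  ∃ (m : ℕ) (i : X →ₗ[A] (Fin m → M)) (p : (Fin m → M) →ₗ[A] X), p ∘ₗ i = LinearMap.id

/-- `Ext¹_A(M, X) = 0`. -/
def ExtOneVanishes {A : Type u} [CommRing A] (M X : ModuleCat.{u} A) : Prop :=
  Subsingleton (CategoryTheory.Abelian.Ext.{u} M X 1)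

/-- `M` is a rigid object in `CM(R)`. -/
def IsRigidObject (M : ModuleCat.{u} R) : Prop :=
  IsMaximalCohenMacaulay R M ∧ ExtOneVanishes M M

/-- `M` is a cluster tilting object in `CM(R)`: it lies in `CM(R)`, and
`add M = {X ∈ CM(R) | Ext¹(M, X) = 0} = {X ∈ CM(R) | Ext¹(X, M) = 0}`. -/
def IsClusterTilting (M : ModuleCat.{u} R) : Prop :=
  IsMaximalCohenMacaulay R M ∧
    {X : ModuleCat.{u} R | InAdd M X} =
      {X | IsMaximalCohenMacaulay R X ∧ ExtOneVanishes M X} ∧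
    {X : ModuleCat.{u} R | InAdd M X} =
      {X | IsMaximalCohenMacaulay R X ∧ ExtOneVanishes X M}

end General

section Quotients

variable {S : Type u} [CommRing S] {n : ℕ}

/-- `S / (f₁ ⋯ fₙ)`. -/
abbrev QuotProd (f : Fin n → S) : Type u := S ⧸ Ideal.span {∏ j, f j}

theorem isLocalRing_quotProd [IsLocalRing S] (f : Fin n → S)
    (hf : ∏ j, f j ∈ IsLocalRing.maximalIdeal S) : IsLocalRing (QuotProd f) := by
  have : Nontrivial (QuotProd f) := by
    refine Ideal.Quotient.nontrivial_iff.mpr fun h => ?_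
    refine (IsLocalRing.maximalIdeal.isMaximal S).ne_top (top_le_iff.mp (h ▸ ?_))
    exact (Ideal.span_singleton_le_iff_mem _).mpr hf
  exact IsLocalRing.of_surjective' (Ideal.Quotient.mk _) Ideal.Quotient.mk_surjective

theorem span_prod_le (f : Fin n → S) (i : Fin n) :
    Ideal.span {∏ j, f j} ≤ Ideal.span {∏ j ∈ Finset.Iic i, f j} := by
  rw [Ideal.span_singleton_le_span_singleton]
  exact Finset.prod_dvd_prod_of_subset _ _ _ (Finset.subset_univ _)

/-- `S / (f₁ ⋯ fᵢ)`, as a module over `S / (f₁ ⋯ fₙ)` through the canonical surjection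
`S / (f₁ ⋯ fₙ) → S / (f₁ ⋯ fᵢ)`. -/
noncomputable def partialQuot (f : Fin n → S) (i : Fin n) : ModuleCat.{u} (QuotProd f) :=
  (ModuleCat.restrictScalars (Ideal.Quotient.factor (span_prod_le f i))).obj
    (ModuleCat.of (S ⧸ Ideal.span {∏ j ∈ Finset.Iic i, f j})
      (S ⧸ Ideal.span {∏ j ∈ Finset.Iic i, f j}))

/-- `⨁ᵢ S / (f₁ ⋯ fᵢ)`, the sum over `i = 1, …, n`, as a module over `S / (f₁ ⋯ fₙ)`. -/
noncomputable def sumPartialQuot (f : Fin n → S) : ModuleCat.{u} (QuotProd f) :=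
  ModuleCat.of (QuotProd f) (∀ i : Fin n, partialQuot f i)

end Quotients

end CMCluster

/-!
For `M = ⨁ᵢ S / (f₁ ⋯ fᵢ)`, the condition `Ext¹(M, X) = 0` says that the kernel of `fᵢ₊₁ ⋯ fₙ` on `X`
is `f₁ ⋯ fᵢ X` for all `i`. When the branches `fᵢ` are smooth, induction on `n` along `f₁ X ⊆ X` then
decomposes `X` into modules `S / (f₁ ⋯ fᵢ)`. The condition `Ext¹(X, M) = 0` reduces to this one by the
duality `Hom(-, R)`: `M` is self-dual, and `X` is reflexive because it is the cokernel of a matrix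
factorization.
-/

/-! Put F = f₁⋯fₙ, pᵢ = f₁⋯fᵢ and qᵢ = fᵢ₊₁⋯fₙ. In R = S/(F) the annihilator of pᵢ is (qᵢ) and
conversely, so Ext¹(Sᵢ, X) is the kernel of qᵢ on X modulo pᵢX
(`extOneVanishes_sumPartialQuot_iff`). Rigidity is then divisibility in S: R being reduced,
complementary divisors of F are coprime (`dvd_of_dvd_mul_of_isReduced`).

For (b), let X have depth one and satisfy this exactness. The kernel of f₂⋯fₙ is f₁X, so X/f₁X ≅
f₂⋯fₙX ⊆ X has positive depth. It is a module over S/(f₁), a discrete valuation ring since f₁ is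
smooth, and is therefore free. The module f₁X inherits the hypotheses for f₂, …, fₙ. Lifting a
decomposition of f₁X and adding generators killed by f₁ decomposes X (`hasCyclicDecomposition`).

If instead Ext¹(X, M) = 0, lifting along 0 → M → Rⁿ → Rⁿ gives the same exactness for X* = Hom(X, R)
(`exact_dual_of_extOneVanishes`). Hence X* ∈ add M, and dualizing again returns X, which is
reflexive (`bijective_eval_of_regular`). Infinitude of k provides a line t transversal to all
branches, which is regular on every X of depth one. -/

namespace CMCluster

open IsLocalRing

/-! ### Vanishing of Ext¹ as a lifting or extension property -/

section ExtCriteria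

open CategoryTheory Abelian

variable {A : Type u} [CommRing A]

/-- `Ext¹(Y, Z)` vanishes iff maps from `Y` lift along every surjection with kernel `Z`. -/
theorem extOneVanishes_iff_lift (Y Z : ModuleCat.{u} A) :
    ExtOneVanishes Y Z ↔ ∀ (E W : ModuleCat.{u} A) (a : Z →ₗ[A] E) (b : E →ₗ[A] W),
      Function.Injective a → Function.Exact a b → Function.Surjective b →
      ∀ φ : Y →ₗ[A] W, ∃ ψ : Y →ₗ[A] E, b ∘ₗ ψ = φ := by
  constructor
  · intro h E W a b ha hab hb φ
    have : Subsingleton (Ext.{u} Y Z 1) := h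
    let T : ShortComplex (ModuleCat.{u} A) :=
      ShortComplex.mk (ModuleCat.ofHom a) (ModuleCat.ofHom b) (by
        ext x
        exact hab.apply_apply_eq_zero x)
    have hT : T.ShortExact := ModuleCat.shortComplex_shortExact T hab ha hb
    obtain ⟨x₂, hx₂⟩ := Ext.covariant_sequence_exact₃ Y hT (Ext.mk₀ (ModuleCat.ofHom φ))
      (n₁ := 1) rfl (Subsingleton.elim (α := Ext.{u} Y Z 1) _ _)
    obtain ⟨ψ, rfl⟩ := (Ext.mk₀_bijective _ _).2 x₂
    rw [Ext.mk₀_comp_mk₀] at hx₂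
    have := (Ext.mk₀_bijective _ _).1 hx₂
    exact ⟨ψ.hom, congrArg ModuleCat.Hom.hom this⟩
  · intro h
    refine subsingleton_of_forall_eq 0 fun x => ?_
    let I := Injective.under Z
    let T : ShortComplex (ModuleCat.{u} A) :=
      ShortComplex.mk (Injective.ι Z) (Limits.cokernel.π (Injective.ι Z)) (by simp)
    have hT : T.ShortExact :=
      { exact := ShortComplex.exact_cokernel _ }
    -- The class dies in the injective hull term, so it is the pullback of 0 → Z → I → I/Z along
    -- some φ; a lift of φ to I makes it zero.
    obtain ⟨x₃, hx₃⟩ := Ext.covariant_sequence_exact₁ Y hT x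
      (Ext.eq_zero_of_injective (I := Injective.under Z) _) (n₀ := 0) rfl
    obtain ⟨φ, rfl⟩ := (Ext.mk₀_bijective _ _).2 x₃
    obtain ⟨ψ, hψ⟩ := h T.X₂ T.X₃ T.f.hom T.g.hom ((ModuleCat.mono_iff_injective _).1 hT.mono_f)
      ((ShortComplex.ShortExact.moduleCat_exact_iff_function_exact T).1 hT.exact)
      ((ModuleCat.epi_iff_surjective _).1 hT.epi_g) φ.hom
    have e : ModuleCat.ofHom ψ ≫ T.g = φ := by
      ext x
      exact LinearMap.congr_fun hψ x
    rw [← hx₃, ← e, ← Ext.mk₀_comp_mk₀, Ext.comp_assoc _ _ _ _ (zero_add 1) rfl, hT.comp_extClass,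
      Ext.comp_zero]

/-- `Ext¹(Y, Z)` computed from the first step of a projective resolution. -/
theorem extOneVanishes_iff_extend {K P Y Z : ModuleCat.{u} A} [Module.Projective A P]
    (a : K →ₗ[A] P) (b : P →ₗ[A] Y) (ha : Function.Injective a) (hab : Function.Exact a b)
    (hb : Function.Surjective b) :
    ExtOneVanishes Y Z ↔ ∀ φ : K →ₗ[A] Z, ∃ ψ : P →ₗ[A] Z, ψ ∘ₗ a = φ := by
  let T : ShortComplex (ModuleCat.{u} A) :=
    ShortComplex.mk (ModuleCat.ofHom a) (ModuleCat.ofHom b) (by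
      ext x
      exact hab.apply_apply_eq_zero x)
  have hT : T.ShortExact := ModuleCat.shortComplex_shortExact T hab ha hb
  constructor
  · intro h φ
    have : Subsingleton (Ext.{u} Y Z 1) := h
    obtain ⟨x₂, hx₂⟩ := Ext.contravariant_sequence_exact₁ hT Z (Ext.mk₀ (ModuleCat.ofHom φ))
      (n₁ := 1) rfl (Subsingleton.elim (α := Ext.{u} Y Z 1) _ _)
    obtain ⟨ψ, rfl⟩ := (Ext.mk₀_bijective _ _).2 x₂
    rw [Ext.mk₀_comp_mk₀] at hx₂
    have := (Ext.mk₀_bijective _ _).1 hx₂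
    exact ⟨ψ.hom, congrArg ModuleCat.Hom.hom this⟩
  · intro h
    refine subsingleton_of_forall_eq 0 fun x => ?_
    have : Projective P := (IsProjective.iff_projective P).1 inferInstance
    obtain ⟨x₁, hx₁⟩ := Ext.contravariant_sequence_exact₃ hT Z x
      (Ext.eq_zero_of_projective (P := P) _) (n₀ := 0) rfl
    obtain ⟨φ, rfl⟩ := (Ext.mk₀_bijective _ _).2 x₁
    obtain ⟨ψ, hψ⟩ := h φ.hom
    have e : T.f ≫ ModuleCat.ofHom ψ = φ := by
      ext x
      exact LinearMap.congr_fun hψ x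
    rw [← hx₁, ← e, ← Ext.mk₀_comp_mk₀, ← Ext.comp_assoc _ _ _ rfl _ (by rfl), hT.extClass_comp,
      Ext.zero_comp]

theorem InAdd.extOneVanishes_left {M X Z : ModuleCat.{u} A} (hX : InAdd M X)
    (h : ExtOneVanishes M Z) : ExtOneVanishes X Z := by
  obtain ⟨m, i, p, hpi⟩ := hX
  rw [extOneVanishes_iff_lift] at h ⊢
  intro E W a b ha hab hb φ
  choose ψ hψ using fun j : Fin m =>
    h E W a b ha hab hb (φ ∘ₗ p ∘ₗ LinearMap.single A (fun _ : Fin m => M) j)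
  refine ⟨(LinearMap.lsum A (fun _ : Fin m => M) A ψ) ∘ₗ i, ?_⟩
  have : b ∘ₗ (LinearMap.lsum A (fun _ : Fin m => M) A ψ) = φ ∘ₗ p := by
    refine LinearMap.pi_ext' fun j => ?_
    ext x
    rw [LinearMap.comp_apply, LinearMap.comp_apply, LinearMap.coe_single, LinearMap.lsum_piSingle]
    exact LinearMap.congr_fun (hψ j) x
  rw [← LinearMap.comp_assoc, this, LinearMap.comp_assoc, hpi, LinearMap.comp_id]

end ExtCriteria

/-! ### Decomposition along smooth branches -/

section Structure

variable {S : Type u} [CommRing S] [IsLocalRing S]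

/-- A set of relations that can be divided by an element of the maximal ideal modulo `I` has all its
coefficients in `I`. -/
theorem mem_of_descent [IsNoetherianRing S] {ι : Type*} (I : Ideal S) {t : S}
    (ht : t ∈ maximalIdeal S) (P : (ι → S) → Prop)
    (hP : ∀ c, P c → ∃ e, P e ∧ ∀ j, c j - t * e j ∈ I) {c : ι → S} (hc : P c) (j : ι) :
    c j ∈ I := by
  -- Dividing n times puts the coefficients in 𝔪ⁿ(S/I); Krull's intersection theorem concludes.
  have key : ∀ (n : ℕ) (c : ι → S), P c → ∀ j,
      Ideal.Quotient.mk I (c j) ∈ (maximalIdeal S ^ n • ⊤ : Submodule S (S ⧸ I)) := by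
    intro n
    induction n with
    | zero => simp
    | succ n ih =>
      intro c hc j
      obtain ⟨e, he, hce⟩ := hP c hc
      have : Ideal.Quotient.mk I (c j) = t • Ideal.Quotient.mk I (e j) :=
        Ideal.Quotient.eq.2 (hce j)
      rw [this, pow_succ', mul_smul]
      exact Submodule.smul_mem_smul ht (ih e he j)
  have h0 : Ideal.Quotient.mk I (c j) ∈ (⊥ : Submodule S (S ⧸ I)) := by
    rw [← Ideal.iInf_pow_smul_eq_bot_of_isLocalRing (maximalIdeal S)
      (Ideal.IsPrime.ne_top inferInstance), Submodule.mem_iInf]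
    exact fun n => key n c hc j
  exact Ideal.Quotient.eq_zero_iff_mem.1 h0

/-- Generators modulo `L` extend by a minimal system of elements of `L` to a system of generators. -/
theorem exists_minimal_extension {X ι : Type*} [AddCommGroup X] [Module S X] [Fintype ι]
    (x : ι → X) (L : Submodule S X) (hL : L.FG) (h : Submodule.span S (Set.range x) ⊔ L = ⊤) :
    ∃ T : Finset X, (∀ y ∈ T, y ∈ L) ∧ Submodule.span S (Set.range x ∪ T) = ⊤ ∧
      ∀ (c : ι → S) (b : T → S), ∑ j, c j • x j + ∑ y, b y • (y : X) = 0 →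
        ∀ y, b y ∈ maximalIdeal S := by
  classical
  let p : Finset X → Prop := fun T =>
    (∀ y ∈ T, y ∈ L) ∧ Submodule.span S (Set.range x ∪ T) = ⊤
  have hex : ∃ T, p T := by
    obtain ⟨T, rfl⟩ := hL
    exact ⟨T, fun y hy => Submodule.subset_span hy, by rw [Submodule.span_union, h]⟩
  obtain ⟨T, hT, hmin⟩ := WellFounded.has_min (InvImage.wf Finset.card wellFounded_lt)
    {T | p T} hex
  refine ⟨T, hT.1, hT.2, fun c b hcb y => ?_⟩
  by_contra hy
  have hu : IsUnit (b y) := by simpa using hy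
  -- A unit coefficient lets the relation be solved for `y`, making it redundant in a family of
  -- least cardinality.
  refine hmin (T.erase y) ⟨fun z hz => hT.1 z (Finset.mem_of_mem_erase hz), ?_⟩
    (Finset.card_erase_lt_of_mem y.2)
  rw [eq_top_iff, ← hT.2, Submodule.span_le]
  set W := Submodule.span S (Set.range x ∪ (T.erase (y : X) : Finset X))
  have hx : ∀ j, x j ∈ W := fun j => Submodule.subset_span (Or.inl ⟨j, rfl⟩)
  have hz : ∀ z ∈ T, z ≠ y → z ∈ W := fun z hz hzy =>
    Submodule.subset_span (Or.inr (by simp [hz, hzy]))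
  have hyW : (y : X) ∈ W := by
    rw [← Finset.add_sum_erase _ _ (Finset.mem_univ y)] at hcb
    have : b y • (y : X) = -(∑ j, c j • x j + ∑ z ∈ Finset.univ.erase y, b z • (z : X)) := by
      rw [eq_neg_iff_add_eq_zero, ← hcb]
      abel
    rw [← Submodule.smul_mem_iff_of_isUnit W hu, this]
    refine W.neg_mem (W.add_mem (W.sum_mem fun j _ => W.smul_mem _ (hx j))
      (W.sum_mem fun z hz' => W.smul_mem _ (hz z z.2 ?_)))
    exact fun e => (Finset.mem_erase.1 hz').1 (Subtype.ext e)
  rintro z (⟨j, rfl⟩ | hzT)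
  · exact hx j
  · by_cases hzy : z = y
    · rw [hzy]; exact hyW
    · exact hz z hzT hzy

/-- `X` is a direct sum of modules `S / (f₁ ⋯ f_d)` with `1 ≤ d ≤ n`. -/
def HasCyclicDecomposition (fs : List S) (X : Type u) [AddCommGroup X] [Module S X] : Prop :=
  ∃ (ι : Type u) (_ : Fintype ι) (x : ι → X) (d : ι → ℕ), (∀ j, 1 ≤ d j ∧ d j ≤ fs.length) ∧
    Submodule.span S (Set.range x) = ⊤ ∧
    ∀ c : ι → S, ∑ j, c j • x j = 0 ↔ ∀ j, (fs.take (d j)).prod ∣ c j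

/-- Positive depth excludes nonzero elements killed by the whole maximal ideal. -/
theorem smul_eq_zero_of_span_pair {X : Type*} [AddCommGroup X] [Module S X] {f t r : S}
    (hm : maximalIdeal S = Ideal.span {f, t}) (hr : r ∈ maximalIdeal S)
    (hrX : ∀ x : X, r • x = 0 → x = 0) {x : X} (hf : f • x = 0) (ht : t • x = 0) : x = 0 := by
  rw [hm, Ideal.mem_span_pair] at hr
  obtain ⟨a, b, rfl⟩ := hr
  exact hrX x (by rw [add_smul, mul_smul, mul_smul, hf, ht, smul_zero, smul_zero, add_zero])

/-- Induction through f₁X. The crux is that every relation between the chosen generators has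
coefficients divisible by f₁, which is the freeness of X/f₁X over S/(f₁). -/
theorem hasCyclicDecomposition [IsDomain S] [IsNoetherianRing S] (fs : List S)
    (hm : ∀ f ∈ fs, ∃ t, maximalIdeal S = Ideal.span {f, t})
    (hc : ∀ p q g, p * q ∣ fs.prod → p ∣ q * g → p ∣ g)
    (X : Type u) [AddCommGroup X] [Module S X] [Module.Finite S X] {r : S}
    (hr : r ∈ maximalIdeal S) (hrX : ∀ x : X, r • x = 0 → x = 0)
    (hX0 : ∀ x : X, fs.prod • x = 0)
    (hX : ∀ (i : ℕ) (x : X), (fs.drop i).prod • x = 0 → ∃ x', x = (fs.take i).prod • x') :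
    HasCyclicDecomposition fs X := by
  classical
  induction fs generalizing X with
  | nil =>
    have h0 : ∀ x : X, x = 0 := fun x => by simpa using hX0 x
    refine ⟨PEmpty, inferInstance, PEmpty.elim, PEmpty.elim, fun j => j.elim, ?_, fun c => ?_⟩
    · rw [eq_top_iff]
      intro x _
      rw [h0 x]
      exact zero_mem _
    · simp
  | cons f gs ih =>
    obtain ⟨t, ht⟩ := hm f (by simp)
    have htm : t ∈ maximalIdeal S := by
      rw [ht]; exact Ideal.subset_span (by simp)
    let X₁ := LinearMap.range (LinearMap.lsmul S X f)
    have hX₁ : ∀ y : X₁, ∃ x : X, f • x = y := fun y => y.2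
    obtain ⟨ι, _, e, d, hd, he, hrel⟩ : HasCyclicDecomposition gs X₁ := by
      refine ih (fun g hg => hm g (by simp [hg]))
        (fun p q g h => hc p q g (h.trans (by simp))) X₁
        (fun y hy => Subtype.ext (hrX y (congrArg Subtype.val hy))) ?_ ?_
      · rintro ⟨_, x, rfl⟩
        apply Subtype.ext
        have := hX0 x
        rw [List.prod_cons, mul_comm, mul_smul] at this
        simpa using this
      · intro i y hy
        -- Cutting `gs` at `i` is cutting `f :: gs` at `i + 1`; the extra factor `f` places the
        -- preimage in `X₁`.
        obtain ⟨x', hx'⟩ := hX (i + 1) y (by simpa using congrArg Subtype.val hy)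
        refine ⟨⟨f • x', x', rfl⟩, Subtype.ext ?_⟩
        rw [hx', List.take_succ_cons, List.prod_cons, mul_comm, mul_smul]
        rfl
    choose x hx using fun j => hX₁ (e j)
    have hfsum : ∀ c : ι → S, f • ∑ j, c j • x j = ((∑ j, c j • e j : X₁) : X) := by
      intro c
      rw [Finset.smul_sum, Submodule.coe_sum]
      exact Finset.sum_congr rfl fun j _ => by
        rw [smul_comm, hx, Submodule.coe_smul]
    obtain ⟨T, hTL, hTspan, hTrel⟩ := exists_minimal_extension x
      (LinearMap.ker (LinearMap.lsmul S X f)) (IsNoetherian.noetherian _) (by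
        rw [eq_top_iff]
        intro v _
        have hv : (⟨f • v, v, rfl⟩ : X₁) ∈ Submodule.span S (Set.range e) := by
          rw [he]; trivial
        obtain ⟨c, hcv⟩ := (Submodule.mem_span_range_iff_exists_fun S).1 hv
        rw [← add_sub_cancel (∑ j, c j • x j) v]
        refine Submodule.add_mem_sup
          (Submodule.sum_mem _ fun j _ => Submodule.smul_mem _ _ (Submodule.subset_span ⟨j, rfl⟩)) ?_
        rw [LinearMap.mem_ker, LinearMap.lsmul_apply, smul_sub, hfsum, hcv, sub_self])
    have hTf : ∀ b : T → S, f • ∑ y, b y • (y : X) = 0 := by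
      intro b
      rw [Finset.smul_sum]
      exact Finset.sum_eq_zero fun y _ => by
        rw [smul_comm, show f • (y : X) = 0 from hTL y y.2, smul_zero]
    let z : ι ⊕ T → X := Sum.elim x (fun y => y)
    have hzsum : ∀ c : ι ⊕ T → S, ∑ j, c j • z j =
        ∑ j, c (Sum.inl j) • x j + ∑ y : T, c (Sum.inr y) • (y : X) := fun c => by
      simp [z]
    have hzspan : Submodule.span S (Set.range z) = ⊤ := by
      rw [← hTspan, Set.Sum.elim_range]
      congr 2
      exact Subtype.range_coe
    have hzall : ∀ v : X, ∃ c : ι ⊕ T → S, ∑ j, c j • z j = v := fun v =>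
      (Submodule.mem_span_range_iff_exists_fun S).1 (hzspan ▸ Submodule.mem_top)
    have hinl : ∀ c : ι ⊕ T → S, ∑ j, c j • z j = 0 →
        ∀ j, (gs.take (d j)).prod ∣ c (Sum.inl j) := by
      intro c h
      rw [hzsum] at h
      have h' := congrArg (f • ·) h
      simp only [smul_add, hTf, hfsum, smul_zero, add_zero] at h'
      exact (hrel fun j => c (Sum.inl j)).1 (Subtype.ext h')
    -- For the lifted generators this uses 1 ≤ `d j`: the product dividing the coefficient is not
    -- empty.
    have hmem0 : ∀ c : ι ⊕ T → S, ∑ j, c j • z j = 0 → ∀ j, c j ∈ maximalIdeal S := by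
      rintro c h (j | y)
      · refine Ideal.mem_of_dvd _ (hinl c h j) ?_
        obtain ⟨h1, h2⟩ := hd j
        obtain ⟨g, gs', rfl⟩ : ∃ g gs', gs = g :: gs' :=
          List.exists_cons_of_length_pos (by omega)
        obtain ⟨k, hk⟩ : ∃ k, d j = k + 1 := ⟨d j - 1, by omega⟩
        rw [hk, List.take_succ_cons, List.prod_cons]
        refine Ideal.mul_mem_right _ _ ?_
        obtain ⟨t', ht'⟩ := hm g (by simp)
        rw [ht']; exact Ideal.subset_span (by simp)
      · rw [hzsum] at h
        exact hTrel _ _ h y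
    have hfm : f ∈ maximalIdeal S := by
      rw [ht]; exact Ideal.subset_span (by simp)
    have hmem : ∀ c : ι ⊕ T → S, (∃ w : X, ∑ j, c j • z j = f • w) →
        ∀ j, c j ∈ maximalIdeal S := by
      rintro c ⟨w, hw⟩ j
      obtain ⟨b, rfl⟩ := hzall w
      have := hmem0 (fun j => c j - f * b j) (by
        simp only [sub_smul, mul_smul, Finset.sum_sub_distrib, hw, Finset.smul_sum, sub_self]) j
      simpa using Ideal.add_mem _ this (Ideal.mul_mem_right (b j) _ hfm)
    -- A relation modulo fX is divisible by the uniformizer `t` modulo `f`, and the quotient is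
    -- again such a relation because X/fX has no `t`-torsion.
    have hdesc : ∀ c : ι ⊕ T → S, (∃ w : X, ∑ j, c j • z j = f • w) →
        ∃ b : ι ⊕ T → S, (∃ w : X, ∑ j, b j • z j = f • w) ∧
          ∀ j, c j - t * b j ∈ Ideal.span {f} := by
      rintro c ⟨w, hw⟩
      have h := hmem c ⟨w, hw⟩
      simp only [ht, Ideal.mem_span_pair] at h
      choose a b hab using h
      refine ⟨b, ?_, fun j => Ideal.mem_span_singleton.2 ⟨a j, by rw [← hab j]; ring⟩⟩
      have htb : t • ∑ j, b j • z j = f • (w - ∑ j, a j • z j) := by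
        rw [smul_sub, ← hw, Finset.smul_sum, Finset.smul_sum, ← Finset.sum_sub_distrib]
        refine Finset.sum_congr rfl fun j _ => ?_
        rw [← hab j, smul_smul, smul_smul, ← sub_smul]
        congr 1
        ring
      have hH : gs.prod • ∑ j, b j • z j = 0 := by
        refine smul_eq_zero_of_span_pair ht hr hrX ?_ ?_
        · rw [← mul_smul, ← List.prod_cons, hX0]
        · rw [smul_comm, htb, ← mul_smul, mul_comm, ← List.prod_cons, hX0]
      simpa using hX 1 (∑ j, b j • z j) (by simpa using hH)
    have hfdvd : ∀ c : ι ⊕ T → S, ∑ j, c j • z j = 0 → ∀ j, f ∣ c j := fun c h j =>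
      Ideal.mem_span_singleton.1 (mem_of_descent (Ideal.span {f}) htm
        (fun c => ∃ w : X, ∑ j, c j • z j = f • w) hdesc (c := c) ⟨0, by simpa using h⟩ j)
    -- A lifted generator gains the factor `f` in its annihilator; an added one is killed by `f`
    -- alone.
    refine ⟨ι ⊕ T, inferInstance, z, Sum.elim (fun j => d j + 1) (fun _ => 1), ?_, hzspan,
      fun c => ⟨fun h => ?_, fun h => ?_⟩⟩
    · rintro (j | y)
      · simpa using (hd j).2
      · simp
    · rintro (j | y)
      · obtain ⟨q, hq⟩ := hinl c h j
        have h1 := hfdvd c h (Sum.inl j)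
        rw [hq] at h1
        have h2 := hc f _ q (by
          rw [List.prod_cons]
          exact mul_dvd_mul_left _ (List.Sublist.prod_dvd_prod (List.take_sublist _ _))) h1
        rw [Sum.elim_inl, List.take_succ_cons, List.prod_cons, hq, mul_comm f]
        exact mul_dvd_mul_left _ h2
      · simpa using hfdvd c h (Sum.inr y)
    · have hl : ∀ j, f * (gs.take (d j)).prod ∣ c (Sum.inl j) := fun j => by
        simpa using h (Sum.inl j)
      have hr' : ∀ y, f ∣ c (Sum.inr y) := fun y => by simpa using h (Sum.inr y)
      choose a ha using hl
      choose b hb using hr'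
      rw [hzsum]
      have e1 : ∑ j, c (Sum.inl j) • x j = 0 := by
        have := (hrel fun j => (gs.take (d j)).prod * a j).2 fun j => dvd_mul_right _ _
        have := (hfsum fun j => (gs.take (d j)).prod * a j).trans (congrArg Subtype.val this)
        rw [Finset.smul_sum] at this
        rw [← this.trans (ZeroMemClass.coe_zero _)]
        exact Finset.sum_congr rfl fun j _ => by rw [ha, mul_assoc, mul_smul]
      have e2 : ∑ y : T, c (Sum.inr y) • (y : X) = 0 := by
        rw [← hTf b, Finset.smul_sum]
        exact Finset.sum_congr rfl fun y _ => by rw [hb, mul_smul]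
      rw [e1, e2, add_zero]

end Structure

/-! ### Matrix factorizations and reflexivity -/

section MatrixFactorization

open Matrix

variable {S : Type u} [CommRing S]

/-- A finitely generated module of depth one over a regular local ring of dimension two has a
presentation by a matrix factorization of any nonzero `F` annihilating it. -/
theorem exists_matrixFactorization [IsLocalRing S] [IsDomain S] [IsNoetherianRing S] {t t' F : S}
    (hm : maximalIdeal S = Ideal.span {t, t'}) (ht0 : t ≠ 0) (htt' : ∀ v, t ∣ t' * v → t ∣ v)
    (X : Type u) [AddCommGroup X] [Module S X] [Module.Finite S X]
    (htX : ∀ x : X, t • x = 0 → x = 0) (hF : ∀ x : X, F • x = 0) :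
    ∃ (m : ℕ) (τ : Type u) (_ : Fintype τ) (_ : DecidableEq τ) (x : Fin m → X)
      (A : Matrix τ (Fin m) S) (B : Matrix (Fin m) τ S),
      Submodule.span S (Set.range x) = ⊤ ∧
      (∀ c : Fin m → S, ∑ l, c l • x l = 0 ↔ ∃ u, u ᵥ* A = c) ∧
      A * B = F • (1 : Matrix τ τ S) ∧ B * A = F • (1 : Matrix (Fin m) (Fin m) S) := by
  classical
  obtain ⟨m, x, hx⟩ := Module.Finite.exists_fin (R := S) (M := X)
  have htm : t ∈ maximalIdeal S := by
    rw [hm]; exact Ideal.subset_span (by simp)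
  have htm' : t' ∈ maximalIdeal S := by
    rw [hm]; exact Ideal.subset_span (by simp)
  let N := LinearMap.ker (Fintype.linearCombination S x)
  have hN : ∀ c : Fin m → S, c ∈ N ↔ ∑ l, c l • x l = 0 := fun c => by
    rw [LinearMap.mem_ker, Fintype.linearCombination_apply]
  obtain ⟨T, -, hTspan, hTrel⟩ := exists_minimal_extension (S := S) (X := N) (ι := Empty)
    Empty.elim ⊤ (IsNoetherian.noetherian _) (by simp)
  have hall : ∀ v : N, ∃ c : T → S, ∑ y, c y • (y : N) = v := fun v => by
    refine (Submodule.mem_span_range_iff_exists_fun S).1 ?_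
    have : Set.range (fun y : T => (y : N)) = T := Subtype.range_coe
    rw [this, ← Set.empty_union (T : Set N), ← Set.range_eq_empty (Empty.elim : Empty → N), hTspan]
    trivial
  have hmem : ∀ c : T → S, (∃ w : N, ∑ y, c y • (y : N) = t • w) →
      ∀ y, c y ∈ maximalIdeal S := by
    rintro c ⟨w, hw⟩ y
    obtain ⟨b, rfl⟩ := hall w
    have := hTrel Empty.elim (fun y => c y - t * b y) (by
      simp only [sub_smul, mul_smul, Finset.sum_sub_distrib, hw, Finset.smul_sum, sub_self,
        Finset.univ_eq_empty, Finset.sum_empty, add_zero]) y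
    simpa using Ideal.add_mem _ this (Ideal.mul_mem_right (b y) _ htm)
  -- The goal is that the syzygy module N is free. As `t` is regular on X, N/tN embeds in (S/t)ᵐ,
  -- where `t'` is regular; so relations modulo `t` can be divided by `t'`.
  have hdesc : ∀ c : T → S, (∃ w : N, ∑ y, c y • (y : N) = t • w) →
      ∃ b : T → S, (∃ w : N, ∑ y, b y • (y : N) = t • w) ∧
        ∀ y, c y - t' * b y ∈ Ideal.span {t} := by
    rintro c ⟨w, hw⟩
    have h := hmem c ⟨w, hw⟩
    simp only [hm, Ideal.mem_span_pair] at h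
    choose a b hab using h
    refine ⟨b, ?_, fun y => Ideal.mem_span_singleton.2 ⟨a y, by rw [← hab y]; ring⟩⟩
    have htb : t' • ∑ y, b y • (y : N) = t • (w - ∑ y, a y • (y : N)) := by
      rw [smul_sub, ← hw, Finset.smul_sum, Finset.smul_sum, ← Finset.sum_sub_distrib]
      refine Finset.sum_congr rfl fun y _ => ?_
      rw [← hab y]
      module
    have hdvd : ∀ l, t ∣ ((∑ y, b y • (y : N) : N) : Fin m → S) l := fun l =>
      htt' _ ⟨((w - ∑ y, a y • (y : N) : N) : Fin m → S) l, by
        have := congrFun (congrArg Subtype.val htb) l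
        simpa only [Submodule.coe_smul, Pi.smul_apply, smul_eq_mul] using this⟩
    choose v hv using hdvd
    have hv' : ((∑ y, b y • (y : N) : N) : Fin m → S) = t • v := funext hv
    have hvN : v ∈ N := by
      rw [LinearMap.mem_ker]
      refine htX _ ?_
      rw [← map_smul, ← hv']
      exact (∑ y, b y • (y : N) : N).2
    exact ⟨⟨v, hvN⟩, Subtype.ext hv'⟩
  -- A genuine relation is thus divisible by `t` with quotient a relation, so a second descent, now
  -- modulo 0, kills it.
  have hindep : ∀ c : T → S, ∑ y, c y • (y : N) = 0 → c = 0 := by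
    intro c hc
    funext y
    refine (Ideal.mem_bot (R := S)).1 (mem_of_descent ⊥ htm
      (fun c : T → S => ∑ y, c y • (y : N) = 0) (fun c hc => ?_) hc y)
    have hdvd : ∀ y, t ∣ c y := fun y => Ideal.mem_span_singleton.1 (mem_of_descent
      (Ideal.span {t}) htm' (fun c : T → S => ∃ w : N, ∑ y, c y • (y : N) = t • w)
        hdesc (c := c) ⟨0, by rw [hc, smul_zero]⟩ y)
    choose a ha using hdvd
    refine ⟨a, ?_, fun y => by simp [ha]⟩
    have : t • ∑ y, a y • (y : N) = 0 := by
      rw [← hc, Finset.smul_sum]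
      exact Finset.sum_congr rfl fun y _ => by rw [ha, mul_smul]
    exact (smul_eq_zero.1 this).resolve_left ht0
  let A : Matrix T (Fin m) S := fun y l => ((y : N) : Fin m → S) l
  have hA : ∀ u : T → S, u ᵥ* A = ((∑ y, u y • (y : N) : N) : Fin m → S) := fun u => by
    funext l
    simp [Matrix.vecMul, dotProduct, A]
  have hFe : ∀ l : Fin m, F • (Pi.single l 1 : Fin m → S) ∈ N := fun l => by
    rw [LinearMap.mem_ker, map_smul, hF]
  -- `B` expresses the relations F·eₗ by the rows of `A`. The other product follows from ABA = FA,
  -- since the rows of `A` are independent.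
  choose B hB using fun l => hall ⟨_, hFe l⟩
  have hBA : (Matrix.of B) * A = F • (1 : Matrix (Fin m) (Fin m) S) := by
    ext l l'
    have := congrFun ((hA (B l)).trans (congrArg Subtype.val (hB l))) l'
    rw [Matrix.mul_apply_eq_vecMul]
    refine this.trans ?_
    simp [Matrix.one_apply, Pi.single_apply, eq_comm]
  refine ⟨m, T, inferInstance, inferInstance, x, A, Matrix.of B, hx, fun c => ?_, ?_, hBA⟩
  · rw [← hN]
    constructor
    · intro hc
      obtain ⟨u, hu⟩ := hall ⟨c, hc⟩
      exact ⟨u, by rw [hA, hu]⟩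
    · rintro ⟨u, rfl⟩
      rw [hA]
      exact Subtype.mem _
  · have hinj : ∀ u v : T → S, u ᵥ* A = v ᵥ* A → u = v := by
      intro u v h
      refine sub_eq_zero.1 (hindep (u - v) (Subtype.ext ?_))
      rw [← hA, Matrix.sub_vecMul, h, sub_self]
      rfl
    ext y y'
    have : (A * Matrix.of B) y = (F • (1 : Matrix T T S)) y := by
      refine hinj _ _ ?_
      have h1 : (A * Matrix.of B) * A = (F • (1 : Matrix T T S)) * A := by
        rw [Matrix.mul_assoc, hBA]
        simp
      simpa only [Matrix.mul_apply_eq_vecMul] using congrFun h1 y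
    exact congrFun this y'

/-- Linear maps out of a module with given generators and relations. -/
theorem exists_linearMap_of_relations {R : Type*} [CommRing R] {ι X Z : Type*} [Fintype ι]
    [AddCommGroup X] [Module R X] [AddCommGroup Z] [Module R Z] (x : ι → X)
    (hx : Submodule.span R (Set.range x) = ⊤) (z : ι → Z)
    (h : ∀ c : ι → R, ∑ j, c j • x j = 0 → ∑ j, c j • z j = 0) :
    ∃ φ : X →ₗ[R] Z, ∀ j, φ (x j) = z j := by
  classical
  have hs : Function.Surjective (Fintype.linearCombination R x) := by
    rw [← LinearMap.range_eq_top, Fintype.range_linearCombination, hx]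
  let e := (Fintype.linearCombination R x).quotKerEquivOfSurjective hs
  refine ⟨(Submodule.liftQ _ (Fintype.linearCombination R z) fun c hc => ?_) ∘ₗ e.symm.toLinearMap,
    fun j => ?_⟩
  · rw [LinearMap.mem_ker, Fintype.linearCombination_apply] at hc ⊢
    exact h c hc
  · have : e.symm (x j) = Submodule.Quotient.mk (Pi.single j 1) := by
      rw [LinearEquiv.symm_apply_eq]
      simp [e, LinearMap.quotKerEquivOfSurjective_apply_mk]
    simp [this]

theorem linearMap_ext_of_span {R : Type*} [CommRing R] {ι X Z : Type*}
    [AddCommGroup X] [Module R X] [AddCommGroup Z] [Module R Z] (x : ι → X)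
    (hx : Submodule.span R (Set.range x) = ⊤) {φ ψ : X →ₗ[R] Z}
    (h : ∀ j, φ (x j) = ψ (x j)) : φ = ψ :=
  LinearMap.ext_on_range hx h

theorem smul_vec_cancel [IsDomain S] {F : S} (hF : F ≠ 0) {κ : Type*} {v w : κ → S}
    (h : F • v = F • w) : v = w :=
  funext fun j => mul_left_cancel₀ hF (congrFun h j)

/-- The cokernel of a matrix factorization of `F` is reflexive over `S / (F)`. -/
theorem bijective_eval_of_matrixFactorization [IsDomain S] {F : S} (hF : F ≠ 0)
    {X : Type*} [AddCommGroup X] [Module (S ⧸ Ideal.span {F}) X] {ι τ : Type*} [Fintype ι]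
    [Fintype τ] [DecidableEq ι] [DecidableEq τ] (x : ι → X)
    (A : Matrix τ ι S) (B : Matrix ι τ S)
    (hx : Submodule.span (S ⧸ Ideal.span {F}) (Set.range x) = ⊤)
    (hrel : ∀ c : ι → S, ∑ l, Ideal.Quotient.mk (Ideal.span {F}) (c l) • x l = 0 ↔
      ∃ u, u ᵥ* A = c)
    (hAB : A * B = F • (1 : Matrix τ τ S)) (hBA : B * A = F • (1 : Matrix ι ι S)) :
    Function.Bijective (Module.Dual.eval (S ⧸ Ideal.span {F}) X) := by
  set q := Ideal.Quotient.mk (Ideal.span {F}) with hq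
  have hq0 : ∀ s, q s = 0 ↔ F ∣ s := fun s => by
    rw [hq, Ideal.Quotient.eq_zero_iff_mem, Ideal.mem_span_singleton]
  have hβ : ∀ y : τ, ∃ β : Module.Dual (S ⧸ Ideal.span {F}) X, ∀ l, β (x l) = q (B l y) := by
    intro y
    refine exists_linearMap_of_relations x hx _ fun c hc => ?_
    choose c' hc' using fun l => Ideal.Quotient.mk_surjective (c l)
    obtain rfl : (fun l => q (c' l)) = c := funext hc'
    obtain ⟨u, rfl⟩ := (hrel c').1 hc
    simp only [smul_eq_mul, ← map_mul, ← map_sum]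
    rw [hq0]
    have : (u ᵥ* A) ᵥ* B = F • u := by
      rw [Matrix.vecMul_vecMul, hAB, Matrix.vecMul_smul, Matrix.vecMul_one]
    exact ⟨u y, congrFun this y⟩
  choose β hβ using hβ
  -- The values c of a functional satisfy Ac = Fu, so Fc = BAc = F·Bu and c = Bu: the columns of `B`
  -- generate the dual.
  have hdual : ∀ φ : Module.Dual (S ⧸ Ideal.span {F}) X, ∃ u : τ → S, φ = ∑ y, q (u y) • β y := by
    intro φ
    choose c hc using fun l => Ideal.Quotient.mk_surjective (φ (x l))
    have hA : ∀ y, F ∣ (A *ᵥ c) y := by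
      intro y
      have h := congrArg φ ((hrel (A y)).2 ⟨Pi.single y 1, by simp; rfl⟩)
      simp only [map_sum, map_smul, map_zero, smul_eq_mul, ← hc] at h
      rw [← hq0, Matrix.mulVec, dotProduct, map_sum]
      simpa only [map_mul] using h
    choose u hu using hA
    have hcu : c = B *ᵥ u := by
      apply smul_vec_cancel hF
      rw [← Matrix.mulVec_smul, ← (funext hu : A *ᵥ c = F • u), Matrix.mulVec_mulVec, hBA,
        Matrix.smul_mulVec, Matrix.one_mulVec]
    refine ⟨u, linearMap_ext_of_span x hx fun l => ?_⟩
    rw [← hc, hcu]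
    simp [Matrix.mulVec, dotProduct, hβ, mul_comm, ← hq]
  constructor
  · rw [injective_iff_map_eq_zero]
    intro v hv
    obtain ⟨c, rfl⟩ := (Submodule.mem_span_range_iff_exists_fun _).1
      (hx ▸ Submodule.mem_top : v ∈ Submodule.span _ (Set.range x))
    choose w hw using fun l => Ideal.Quotient.mk_surjective (c l)
    obtain rfl : (fun l => q (w l)) = c := funext hw
    have hB : ∀ y, F ∣ (w ᵥ* B) y := by
      intro y
      have h : β y (∑ l, q (w l) • x l) = 0 := LinearMap.congr_fun hv (β y)
      simp only [map_sum, map_smul, hβ, smul_eq_mul] at h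
      rw [← hq0, Matrix.vecMul, dotProduct, map_sum]
      simpa only [map_mul] using h
    choose z hz using hB
    refine (hrel w).2 ⟨z, smul_vec_cancel hF ?_⟩
    rw [← Matrix.smul_vecMul, ← (funext hz : w ᵥ* B = F • z), Matrix.vecMul_vecMul, hBA,
      Matrix.vecMul_smul, Matrix.vecMul_one]
  · intro Φ
    choose v hv using fun y => Ideal.Quotient.mk_surjective (Φ (β y))
    -- The columns of `A` are relations between the β because BA = F; applying Φ gives vA ≡ 0 modulo
    -- F, whence v = wB.
    have hA : ∀ l, F ∣ (v ᵥ* A) l := by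
      intro l
      have h : ∑ y, q (A y l) • β y = 0 := by
        refine linearMap_ext_of_span x hx fun l' => ?_
        have := congrArg q (congrFun (congrFun hBA l') l)
        rw [Matrix.smul_apply, smul_eq_mul, map_mul, (hq0 F).2 dvd_rfl, zero_mul, Matrix.mul_apply,
          map_sum] at this
        simpa [hβ, mul_comm] using this
      have h := congrArg Φ h
      simp only [map_sum, map_smul, map_zero, smul_eq_mul, ← hv] at h
      rw [← hq0, Matrix.vecMul, dotProduct, map_sum]
      simpa only [map_mul, mul_comm] using h
    choose w hw using hA
    have hvw : v = w ᵥ* B := by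
      apply smul_vec_cancel hF
      rw [← Matrix.smul_vecMul, ← (funext hw : v ᵥ* A = F • w), Matrix.vecMul_vecMul, hAB,
        Matrix.vecMul_smul, Matrix.vecMul_one]
    refine ⟨∑ l, q (w l) • x l, LinearMap.ext fun φ => ?_⟩
    obtain ⟨u, rfl⟩ := hdual φ
    simp only [map_sum, map_smul]
    refine Finset.sum_congr rfl fun y _ => ?_
    congr 1
    rw [← hv, hvw]
    simp [hβ, Matrix.vecMul, dotProduct, ← hq]

end MatrixFactorization

/-! ### Consequences of reducedness -/

/-- A reduced noetherian local ring that is not a field has positive depth. -/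
theorem exists_mem_maximalIdeal_nonZeroDivisors (R : Type*) [CommRing R] [IsLocalRing R]
    [IsNoetherianRing R] [IsReduced R] (h : maximalIdeal R ≠ ⊥) :
    ∃ r ∈ maximalIdeal R, r ∈ nonZeroDivisors R := by
  by_contra! hr
  obtain ⟨z, hz, hz0⟩ := SetLike.exists_of_lt
    (Ideal.bot_lt_annihilator_of_disjoint_nonZeroDivisors (Set.disjoint_left.2 hr))
  rw [Submodule.mem_annihilator] at hz
  refine hz0 ((Submodule.mem_bot R).2 ?_)
  by_cases hzm : z ∈ maximalIdeal R
  · exact IsReduced.eq_zero z ⟨2, by rw [pow_two]; exact hz z hzm⟩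
  · refine absurd ((Submodule.eq_bot_iff _).2 fun a ha => ?_) h
    have hu : IsUnit z := by simpa using hzm
    exact (hu.mul_right_eq_zero).1 (hz a ha)

/-- If `S / (F)` is reduced, then complementary divisors of `F` behave as coprime elements. -/
theorem dvd_of_dvd_mul_of_isReduced {S : Type*} [CommRing S] [IsDomain S] {F : S} (hF : F ≠ 0)
    (hred : IsReduced (S ⧸ Ideal.span {F})) {p q g : S} (hpq : p * q ∣ F) (h : p ∣ q * g) :
    p ∣ g := by
  obtain ⟨r, rfl⟩ := hpq
  -- Since p divides qg, the square of qgr is divisible by pqr = F.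
  have hnil : IsNilpotent (Ideal.Quotient.mk (Ideal.span {p * q * r}) (q * g * r)) := by
    refine ⟨2, ?_⟩
    rw [← map_pow, Ideal.Quotient.eq_zero_iff_mem, Ideal.mem_span_singleton]
    obtain ⟨s, hs⟩ := h
    exact ⟨s * g * r, by rw [pow_two]; linear_combination (q * g * r * r) * hs⟩
  have h0 := hred.eq_zero _ hnil
  rw [Ideal.Quotient.eq_zero_iff_mem, Ideal.mem_span_singleton] at h0
  obtain ⟨s, hs⟩ := h0
  refine ⟨s, ?_⟩
  have hqr : q * r ≠ 0 := fun e => hF (by rw [mul_assoc, e, mul_zero])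
  exact mul_left_cancel₀ hqr (by linear_combination hs)

/-! ### The ring k[[x, y]] and transversal lines -/

section PowerSeries

open MvPowerSeries

variable {k : Type u} [Field k]

theorem mem_maximalIdeal_iff (g : MvPowerSeries (Fin 2) k) :
    g ∈ maximalIdeal (MvPowerSeries (Fin 2) k) ↔ constantCoeff g = 0 := by
  rw [mem_maximalIdeal, mem_nonunits_iff, MvPowerSeries.isUnit_iff_constantCoeff,
    isUnit_iff_ne_zero, not_not]

theorem X_mem_maximalIdeal (i : Fin 2) : X i ∈ maximalIdeal (MvPowerSeries (Fin 2) k) :=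
  (mem_maximalIdeal_iff _).2 (constantCoeff_X i)

theorem isDomain_mvPowerSeries (σ : Type*) : IsDomain (MvPowerSeries σ k) :=
  NoZeroDivisors.to_isDomain _

theorem maximalIdeal_eq_span_X :
    maximalIdeal (MvPowerSeries (Fin 2) k) = Ideal.span {X 0, X 1} := by
  apply le_antisymm
  · intro g hg
    rw [mem_maximalIdeal_iff] at hg
    -- The part of `g` free of `X 0`; without constant term it is divisible by `X 1`.
    let g₁ : MvPowerSeries (Fin 2) k := fun m => if m 0 = 0 then coeff m g else 0
    have hg₁ : ∀ m, coeff m g₁ = if m 0 = 0 then coeff m g else 0 := fun m => rfl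
    have h0 : X 0 ∣ g - g₁ := by
      rw [X_dvd_iff]
      intro m hm
      rw [map_sub, hg₁, if_pos hm, sub_self]
    have h1 : X 1 ∣ g₁ := by
      rw [X_dvd_iff]
      intro m hm
      rw [hg₁]
      split_ifs with hm0
      · have : m = 0 := by
          ext i
          fin_cases i
          · exact hm0
          · exact hm
        rw [this]
        simpa using hg
      · rfl
    obtain ⟨a, ha⟩ := h0
    obtain ⟨b, hb⟩ := h1
    exact Ideal.mem_span_pair.2 ⟨a, b, by rw [mul_comm, ← ha, mul_comm b, ← hb, sub_add_cancel]⟩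
  · rw [Ideal.span_le]
    rintro g (rfl | rfl) <;> exact X_mem_maximalIdeal _

theorem prime_X_zero : Prime (X 0 : MvPowerSeries (Fin 2) k) := by
  have := isDomain_mvPowerSeries (k := k) (Fin 1)
  rw [← MulEquiv.prime_iff (MvPowerSeries.finSuccEquiv k 1), MvPowerSeries.finSuccEquiv_X_zero]
  exact PowerSeries.X_prime

theorem X_zero_not_dvd (c : k) :
    ¬ (X 0 : MvPowerSeries (Fin 2) k) ∣ X 1 + C c * X 0 := by
  intro h
  have h1 : (X 0 : MvPowerSeries (Fin 2) k) ∣ X 1 := (dvd_add_left (dvd_mul_left _ _)).1 h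
  have := X_dvd_iff.1 h1 (Finsupp.single 1 1) (by simp)
  simp [coeff_X] at this

theorem ringKrullDim_le_two : ringKrullDim (MvPowerSeries (Fin 2) k) ≤ 2 := by
  refine (ringKrullDim_le_spanFinrank_maximalIdeal _).trans ?_
  rw [maximalIdeal_eq_span_X]
  have : (Ideal.span {X 0, X 1} : Ideal (MvPowerSeries (Fin 2) k)).spanFinrank ≤ 2 :=
    (Submodule.spanFinrank_span_le_ncard_of_finite (by simp)).trans 
      ((Set.ncard_insert_le _ _).trans (by simp))
  exact_mod_cast this

/-- Otherwise F divides every element of 𝔪; dividing the prime `X 0` makes it an associate of it,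
yet it also divides `X 1`. -/
theorem maximalIdeal_quotient_ne_bot {F : MvPowerSeries (Fin 2) k}
    (hF : F ∈ maximalIdeal (MvPowerSeries (Fin 2) k))
    [IsLocalRing (MvPowerSeries (Fin 2) k ⧸ Ideal.span {F})] :
    maximalIdeal (MvPowerSeries (Fin 2) k ⧸ Ideal.span {F}) ≠ ⊥ := by
  intro h
  have hdvd : ∀ g ∈ maximalIdeal (MvPowerSeries (Fin 2) k), F ∣ g := by
    intro g hg
    rw [← Ideal.mem_span_singleton, ← Ideal.Quotient.eq_zero_iff_mem, ← Ideal.mem_bot, ← h,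
      mem_maximalIdeal, mem_nonunits_iff]
    intro hu
    have : IsLocalHom (Ideal.Quotient.mk (Ideal.span {F})) :=
      IsLocalHom.of_surjective _ Ideal.Quotient.mk_surjective
    exact (mem_nonunits_iff.1 ((mem_maximalIdeal _).1 hg)) (isUnit_of_map_unit _ _ hu)
  obtain ⟨u, hu⟩ := hdvd (X 0) (X_mem_maximalIdeal _)
  have hX0 : X 0 ∣ F := by
    rcases prime_X_zero.irreducible.isUnit_or_isUnit hu with h' | h'
    · exact absurd h' hF
    · rw [hu]
      exact h'.mul_right_dvd.2 dvd_rfl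
  refine X_zero_not_dvd (0 : k) (hX0.trans ?_)
  simpa using hdvd (X 1) (X_mem_maximalIdeal _)

/-- Over an infinite field there is a line transversal to finitely many smooth branches. -/
theorem exists_transversal [Infinite k] {n : ℕ} (f : Fin n → MvPowerSeries (Fin 2) k)
    (hf : ∀ i, f i ∈ maximalIdeal (MvPowerSeries (Fin 2) k))
    (hf2 : ∀ i, f i ∉ maximalIdeal (MvPowerSeries (Fin 2) k) ^ 2) :
    ∃ t t' : MvPowerSeries (Fin 2) k, t ≠ 0 ∧
      maximalIdeal (MvPowerSeries (Fin 2) k) = Ideal.span {t, t'} ∧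
      (∀ v, t ∣ t' * v → t ∣ v) ∧
      ∀ i, maximalIdeal (MvPowerSeries (Fin 2) k) = Ideal.span {f i, t} := by
  classical
  have h := hf
  simp only [maximalIdeal_eq_span_X, Ideal.mem_span_pair] at h
  choose p q hpq using h
  have hne : ∀ i, constantCoeff (p i) ≠ 0 ∨ constantCoeff (q i) ≠ 0 := by
    intro i
    by_contra! h
    refine hf2 i ?_
    rw [← hpq i, pow_two]
    refine Ideal.add_mem _ (Ideal.mul_mem_mul ((mem_maximalIdeal_iff _).2 h.1) ?_)
      (Ideal.mul_mem_mul ((mem_maximalIdeal_iff _).2 h.2) ?_) <;> exact X_mem_maximalIdeal _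
  -- Modulo t, fᵢ becomes (pᵢ - c qᵢ)·`X 0`, so c must avoid the ratios of linear coefficients. A
  -- zero denominator only excludes the harmless value 0.
  obtain ⟨c, hc⟩ := Infinite.exists_notMem_finset
    (Finset.univ.image fun i => constantCoeff (p i) / constantCoeff (q i))
  have hdet : ∀ i, IsUnit (p i - C c * q i) := by
    intro i
    rw [MvPowerSeries.isUnit_iff_constantCoeff, isUnit_iff_ne_zero, map_sub, map_mul,
      constantCoeff_C, sub_ne_zero]
    intro e
    by_cases hq : constantCoeff (q i) = 0
    · rw [hq, mul_zero] at e
      exact (hne i).elim (fun h => h e) fun h => h hq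
    · exact hc (Finset.mem_image.2 ⟨i, Finset.mem_univ _, by rw [e, mul_div_cancel_right₀ _ hq]⟩)
  set t : MvPowerSeries (Fin 2) k := X 1 + C c * X 0 with ht
  have htm : t ∈ maximalIdeal (MvPowerSeries (Fin 2) k) :=
    (mem_maximalIdeal_iff _).2 (by simp [ht])
  refine ⟨t, X 0, fun h0 => X_zero_not_dvd c (by rw [← ht, h0]; exact dvd_zero _), ?_,
    fun v hv => ?_, fun i => ?_⟩
  · apply le_antisymm
    · rw [maximalIdeal_eq_span_X, Ideal.span_le]
      rintro g (rfl | rfl)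
      · exact Ideal.subset_span (by simp)
      · exact Ideal.mem_span_pair.2 ⟨1, -C c, by rw [ht]; ring⟩
    · rw [Ideal.span_le]
      rintro g (rfl | rfl)
      · exact htm
      · exact X_mem_maximalIdeal _
  · obtain ⟨s, hs⟩ := hv
    obtain ⟨s', rfl⟩ := (prime_X_zero.dvd_or_dvd ⟨v, hs.symm⟩).resolve_left (X_zero_not_dvd c)
    exact ⟨s', mul_left_cancel₀ (prime_X_zero (k := k)).ne_zero (by rw [hs]; ring)⟩
  · apply le_antisymm
    · have h0 : X 0 ∈ Ideal.span {f i, t} := by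
        rw [← Ideal.unit_mul_mem_iff_mem _ (hdet i)]
        exact Ideal.mem_span_pair.2 ⟨1, -q i, by rw [← hpq i, ht]; ring⟩
      rw [maximalIdeal_eq_span_X, Ideal.span_le]
      rintro g (rfl | rfl)
      · exact h0
      · have : (X 1 : MvPowerSeries (Fin 2) k) = t - C c * X 0 := by rw [ht]; ring
        rw [this]
        exact Ideal.sub_mem _ (Ideal.subset_span (by simp)) (Ideal.mul_mem_left _ _ h0)
    · rw [Ideal.span_le]
      rintro g (rfl | rfl)
      · exact hf i
      · exact htm

end PowerSeries

/-! ### Maximal Cohen–Macaulay modules in dimension one -/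

section Depth

variable {R : Type u} [CommRing R] [IsLocalRing R]

theorem isMaximalCohenMacaulay_iff (hdim : ringKrullDim R = 1) (M : ModuleCat.{u} R) :
    IsMaximalCohenMacaulay R M ↔
      Module.Finite R M ∧ ∃ r ∈ maximalIdeal R, ∀ x : M, r • x = 0 → x = 0 := by
  refine and_congr_right fun hfin => ⟨?_, ?_⟩
  · rintro (h | ⟨rs, hrs, hreg, hlen⟩)
    · exact ⟨0, zero_mem _, fun x _ => Subsingleton.elim _ _⟩
    · rw [hdim] at hlen
      have hlen : rs.length = 1 := by exact_mod_cast hlen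
      obtain ⟨r, rfl⟩ := List.length_eq_one_iff.1 hlen
      have := (RingTheory.Sequence.isWeaklyRegular_singleton_iff M r).1 hreg.toIsWeaklyRegular
      exact ⟨r, hrs r (by simp), fun x hx => this.right_eq_zero_of_smul hx⟩
  · rintro ⟨r, hr, hrM⟩
    rcases subsingleton_or_nontrivial M with h | h
    · exact Or.inl h
    · refine Or.inr ⟨[r], by simpa using hr, ?_, by simp [hdim]⟩
      refine RingTheory.Sequence.IsRegular.of_isWeaklyRegular_of_mem_maximalIdeal M
        (by simpa using hr) ((RingTheory.Sequence.isWeaklyRegular_singleton_iff M r).2 ?_)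
      intro x y hxy
      exact sub_eq_zero.1 (hrM _ (by rw [smul_sub, sub_eq_zero]; exact hxy))

end Depth

/-- Dividing by a nonzerodivisor drops the dimension: F does so from at most 2, and a nonzerodivisor
in the maximal ideal of the reduced quotient leaves a nonzero ring. -/
theorem ringKrullDim_quotient_eq_one {k : Type u} [Field k] {F : MvPowerSeries (Fin 2) k}
    (hF : F ≠ 0) (hmem : F ∈ maximalIdeal (MvPowerSeries (Fin 2) k))
    [IsLocalRing (MvPowerSeries (Fin 2) k ⧸ Ideal.span {F})]
    [IsReduced (MvPowerSeries (Fin 2) k ⧸ Ideal.span {F})] :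
    ringKrullDim (MvPowerSeries (Fin 2) k ⧸ Ideal.span {F}) = 1 := by
  apply le_antisymm
  · have h := (ringKrullDim_quotient_succ_le_of_nonZeroDivisor
      (mem_nonZeroDivisors_of_ne_zero hF)).trans ringKrullDim_le_two
    rw [show (2 : WithBot ℕ∞) = 1 + 1 by norm_num] at h
    generalize ringKrullDim (MvPowerSeries (Fin 2) k ⧸ Ideal.span {F}) = d at h ⊢
    induction d using WithBot.recBotCoe with
    | bot => exact bot_le
    | coe d =>
      norm_cast at h ⊢
      exact (ENat.add_le_add_iff_right ENat.one_ne_top).1 (WithBot.coe_le_coe.1 h)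
  · obtain ⟨r, hr, hr0⟩ := exists_mem_maximalIdeal_nonZeroDivisors _
      (maximalIdeal_quotient_ne_bot hmem)
    refine le_trans ?_ (ringKrullDim_quotient_succ_le_of_nonZeroDivisor hr0)
    have : Nontrivial ((MvPowerSeries (Fin 2) k ⧸ Ideal.span {F}) ⧸ Ideal.span {r}) :=
      Ideal.Quotient.nontrivial_iff.2 fun h =>
        hr (Ideal.span_singleton_eq_top.1 h)
    have := ringKrullDim_nonneg_of_nontrivial
      (R := (MvPowerSeries (Fin 2) k ⧸ Ideal.span {F}) ⧸ Ideal.span {r})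
    simpa using add_le_add_left this 1

/-! ### The cyclic modules Sᵢ -/

section Generators

variable {S : Type u} [CommRing S] {n : ℕ} (f : Fin n → S)

/-- The class of `f₁ ⋯ fᵢ` in `S / (f₁ ⋯ fₙ)`. -/
noncomputable def initialProd (i : Fin n) : QuotProd f :=
  Ideal.Quotient.mk _ (∏ j ∈ Finset.Iic i, f j)

/-- The class of `fᵢ₊₁ ⋯ fₙ` in `S / (f₁ ⋯ fₙ)`. -/
noncomputable def finalProd (i : Fin n) : QuotProd f :=
  Ideal.Quotient.mk _ (∏ j ∈ Finset.Ioi i, f j)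

/-- The class of `1` in `S / (f₁ ⋯ fᵢ)`. -/
noncomputable def partialQuotGen (i : Fin n) : partialQuot f i :=
  (1 : S ⧸ Ideal.span {∏ j ∈ Finset.Iic i, f j})

theorem prod_Iic_mul_prod_Ioi (i : Fin n) :
    (∏ j ∈ Finset.Iic i, f j) * ∏ j ∈ Finset.Ioi i, f j = ∏ j, f j := by
  rw [← Finset.prod_union]
  · congr 1
    ext j
    simp [le_or_gt]
  · rw [Finset.disjoint_left]
    intro j
    simp

theorem mk_smul_partialQuotGen (i : Fin n) (s : S) :
    (Ideal.Quotient.mk _ s : QuotProd f) • partialQuotGen f i =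
      (Ideal.Quotient.mk _ s : S ⧸ Ideal.span {∏ j ∈ Finset.Iic i, f j}) :=
  mul_one (Ideal.Quotient.mk (Ideal.span {∏ j ∈ Finset.Iic i, f j}) s)

theorem exists_smul_partialQuotGen (i : Fin n) (y : partialQuot f i) :
    ∃ c : QuotProd f, c • partialQuotGen f i = y := by
  obtain ⟨s, hs⟩ := Ideal.Quotient.mk_surjective
    (I := Ideal.span {∏ j ∈ Finset.Iic i, f j}) y
  exact ⟨Ideal.Quotient.mk _ s, (mk_smul_partialQuotGen f i s).trans hs⟩

theorem mk_smul_partialQuotGen_eq_zero_iff (i : Fin n) (s : S) :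
    (Ideal.Quotient.mk _ s : QuotProd f) • partialQuotGen f i = 0 ↔
      ∏ j ∈ Finset.Iic i, f j ∣ s := by
  rw [mk_smul_partialQuotGen, ← Ideal.mem_span_singleton]
  exact Ideal.Quotient.eq_zero_iff_mem

theorem smul_partialQuotGen_eq_zero_iff (i : Fin n) (c : QuotProd f) :
    c • partialQuotGen f i = 0 ↔ initialProd f i ∣ c := by
  obtain ⟨s, rfl⟩ := Ideal.Quotient.mk_surjective c
  rw [mk_smul_partialQuotGen_eq_zero_iff]
  constructor
  · exact fun h => map_dvd _ h
  · rintro ⟨d, hd⟩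
    obtain ⟨d, rfl⟩ := Ideal.Quotient.mk_surjective d
    rw [initialProd, ← map_mul, Ideal.Quotient.eq, Ideal.mem_span_singleton] at hd
    have := (Dvd.intro _ (prod_Iic_mul_prod_Ioi f i)).trans hd
    exact (dvd_sub_left (dvd_mul_right _ _)).1 this

theorem span_partialQuotGen (i : Fin n) :
    Submodule.span (QuotProd f) (Set.range fun _ : Unit => partialQuotGen f i) = ⊤ := by
  rw [eq_top_iff]
  intro y _
  obtain ⟨c, rfl⟩ := exists_smul_partialQuotGen f i y
  exact Submodule.smul_mem _ _ (Submodule.subset_span ⟨(), rfl⟩)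

theorem exists_linearMap_partialQuot {X : Type*} [AddCommGroup X] [Module (QuotProd f) X]
    (i : Fin n) {x : X} (hx : initialProd f i • x = 0) :
    ∃ φ : partialQuot f i →ₗ[QuotProd f] X, φ (partialQuotGen f i) = x := by
  obtain ⟨φ, hφ⟩ := exists_linearMap_of_relations _ (span_partialQuotGen f i) (fun _ => x) (by
    intro c hc
    simp only [Finset.univ_unique, Finset.sum_singleton, smul_partialQuotGen_eq_zero_iff] at hc ⊢
    obtain ⟨b, hb⟩ := hc
    rw [hb, mul_comm, mul_smul, hx, smul_zero])
  exact ⟨φ, hφ ()⟩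

theorem initialProd_mul_finalProd (i : Fin n) : initialProd f i * finalProd f i = 0 := by
  rw [initialProd, finalProd, ← map_mul, prod_Iic_mul_prod_Ioi, Ideal.Quotient.eq_zero_iff_mem]
  exact Ideal.mem_span_singleton_self _

variable [IsDomain S] {f}

/-- Cancel pᵢ from F = pᵢqᵢ in the domain S. With its mirror image below, this gives the 2-periodic
resolution of Sᵢ. -/
theorem mul_initialProd_eq_zero (hf : ∏ j, f j ≠ 0) {i : Fin n} {c : QuotProd f} (h : c * initialProd f i = 0) :
    finalProd f i ∣ c := by
  obtain ⟨s, rfl⟩ := Ideal.Quotient.mk_surjective c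
  rw [initialProd, ← map_mul, Ideal.Quotient.eq_zero_iff_mem, Ideal.mem_span_singleton,
    ← prod_Iic_mul_prod_Ioi f i, mul_comm s] at h
  rw [← prod_Iic_mul_prod_Ioi f i] at hf
  exact map_dvd _ ((mul_dvd_mul_iff_left (left_ne_zero_of_mul hf)).1 h)

theorem mul_finalProd_eq_zero (hf : ∏ j, f j ≠ 0) {i : Fin n} {c : QuotProd f} (h : c * finalProd f i = 0) :
    initialProd f i ∣ c := by
  obtain ⟨s, rfl⟩ := Ideal.Quotient.mk_surjective c
  rw [finalProd, ← map_mul, Ideal.Quotient.eq_zero_iff_mem, Ideal.mem_span_singleton,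
    ← prod_Iic_mul_prod_Ioi f i] at h
  rw [← prod_Iic_mul_prod_Ioi f i] at hf
  exact map_dvd _ ((mul_dvd_mul_iff_right (right_ne_zero_of_mul hf)).1 h)

end Generators

/-! ### Rigidity and self-duality of M -/

section SumPartialQuot

variable {S : Type u} [CommRing S] {n : ℕ} {f : Fin n → S}

/-- The presentation of `⨁ᵢ S / (f₁ ⋯ fᵢ)` by one generator for each `i`. -/
noncomputable def sumPartialQuotCover (f : Fin n → S) :
    (Fin n → QuotProd f) →ₗ[QuotProd f] sumPartialQuot f :=
  LinearMap.pi fun i => LinearMap.toSpanSingleton _ _ (partialQuotGen f i) ∘ₗ LinearMap.proj i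

theorem sumPartialQuotCover_surjective : Function.Surjective (sumPartialQuotCover f) := by
  intro y
  choose c hc using fun i => exists_smul_partialQuotGen f i ((y : ∀ i, partialQuot f i) i)
  exact ⟨c, funext hc⟩

/-- `Ext¹(⨁ᵢ S / (f₁ ⋯ fᵢ), X)` measures the exactness of multiplication by `f₁ ⋯ fᵢ` and
`fᵢ₊₁ ⋯ fₙ` on `X`. -/
theorem extOneVanishes_sumPartialQuot_iff [IsDomain S] (hf : ∏ j, f j ≠ 0)
    (X : ModuleCat.{u} (QuotProd f)) :
    ExtOneVanishes (sumPartialQuot f) X ↔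
      ∀ (i : Fin n) (x : X), finalProd f i • x = 0 → ∃ x', x = initialProd f i • x' := by
  classical
  let K := LinearMap.ker (sumPartialQuotCover f)
  let P : ModuleCat.{u} (QuotProd f) := ModuleCat.of _ (Fin n → QuotProd f)
  have : Module.Projective (QuotProd f) P :=
    inferInstanceAs (Module.Projective (QuotProd f) (Fin n → QuotProd f))
  rw [extOneVanishes_iff_extend (K := ModuleCat.of _ K) (P := P) K.subtype (sumPartialQuotCover f)
    K.injective_subtype (LinearMap.exact_subtype_ker_map _) sumPartialQuotCover_surjective]
  have hK : ∀ c : Fin n → QuotProd f, c ∈ K ↔ ∀ i, initialProd f i ∣ c i := by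
    intro c
    rw [LinearMap.mem_ker]
    exact funext_iff.trans (forall_congr' fun i => smul_partialQuotGen_eq_zero_iff f i (c i))
  have hgen : ∀ i, Pi.single i (initialProd f i) ∈ K := fun i => by
    rw [hK]
    intro j
    by_cases h : j = i
    · subst h; simp
    · simp [h]
  let g : Fin n → K := fun i => ⟨_, hgen i⟩
  have hgsum : ∀ c : Fin n → QuotProd f, ((∑ i, c i • g i : K) : Fin n → QuotProd f) =
      fun i => c i * initialProd f i := by
    intro c
    funext j
    simp [g, Finset.sum_apply, Pi.single_apply]
  have hspan : Submodule.span (QuotProd f) (Set.range g) = ⊤ := by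
    rw [eq_top_iff]
    rintro ⟨v, hv⟩ -
    choose c hc using (hK v).1 hv
    refine (Submodule.mem_span_range_iff_exists_fun _).2 ⟨c, Subtype.ext ?_⟩
    rw [hgsum]
    exact funext fun i => (mul_comm _ _).trans (hc i).symm
  constructor
  · intro h i x hx
    -- The kernel K is the sum of the pᵢR, whose generators have relations qᵢ; an element killed by
    -- qᵢ thus defines a map on K, and extending it to Rⁿ divides it by pᵢ.
    obtain ⟨φ, hφ⟩ := exists_linearMap_of_relations g hspan (Pi.single i x) (by
      intro c hc
      have := congrFun ((hgsum c).symm.trans (congrArg Subtype.val hc)) i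
      obtain ⟨d, hd⟩ := mul_initialProd_eq_zero hf this
      rw [Finset.sum_eq_single i
        (fun j _ hj => by rw [Pi.single_eq_of_ne hj, smul_zero])
        (fun h => absurd (Finset.mem_univ i) h), Pi.single_eq_same, hd,
        mul_comm, mul_smul, hx, smul_zero])
    obtain ⟨ψ, hψ⟩ := h φ
    let ψ' : (Fin n → QuotProd f) →ₗ[QuotProd f] X := ψ
    refine ⟨ψ' (Pi.single i 1), ?_⟩
    have h1 : φ (g i) = x := by rw [hφ, Pi.single_eq_same]
    have h2 : φ (g i) = ψ' (Pi.single i (initialProd f i)) := (LinearMap.congr_fun hψ (g i)).symm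
    rw [← map_smul, ← h1, h2, ← Pi.single_smul, smul_eq_mul, mul_one]
  · intro h φ
    let φ' : K →ₗ[QuotProd f] X := φ
    have hg : ∀ i, finalProd f i • g i = 0 := fun i => by
      refine Subtype.ext ?_
      change finalProd f i • (Pi.single i (initialProd f i) : Fin n → QuotProd f) = 0
      rw [← Pi.single_smul, smul_eq_mul, mul_comm, initialProd_mul_finalProd, Pi.single_zero]
    choose x' hx' using fun i => h i (φ' (g i)) (by rw [← map_smul, hg, map_zero])
    refine ⟨Fintype.linearCombination (QuotProd f) x', ?_⟩
    refine linearMap_ext_of_span g hspan fun i => ?_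
    refine Eq.trans ?_ (hx' i).symm
    exact Fintype.linearCombination_apply_single (QuotProd f) x' i (initialProd f i)

/-- In the coordinate Sⱼ, suppose pⱼ divides qᵢs. If j ≤ i, coprimality gives pⱼ ∣ s. If i < j,
cancelling fᵢ₊₁⋯fⱼ leaves pᵢ ∣ qⱼs, and coprimality gives pᵢ ∣ s. -/
theorem extOneVanishes_self [IsDomain S] (hf : ∏ j, f j ≠ 0)
    (hred : IsReduced (S ⧸ Ideal.span {∏ j, f j})) :
    ExtOneVanishes (sumPartialQuot f) (sumPartialQuot f) := by
  rw [extOneVanishes_sumPartialQuot_iff hf]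
  intro i y hy
  suffices h : ∀ j, ∃ z, (y : ∀ j, partialQuot f j) j = initialProd f i • z by
    choose z hz using h
    exact ⟨z, funext hz⟩
  intro j
  have hyj : finalProd f i • (y : ∀ j, partialQuot f j) j = 0 := congrFun hy j
  obtain ⟨c, hc⟩ := exists_smul_partialQuotGen f j ((y : ∀ j, partialQuot f j) j)
  rw [← hc] at hyj ⊢
  obtain ⟨s, rfl⟩ := Ideal.Quotient.mk_surjective c
  rw [smul_smul, finalProd, ← map_mul, mk_smul_partialQuotGen_eq_zero_iff] at hyj
  rcases le_or_gt j i with hji | hij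
  · refine ⟨0, ?_⟩
    rw [smul_zero, mk_smul_partialQuotGen_eq_zero_iff]
    refine dvd_of_dvd_mul_of_isReduced hf hred ?_ hyj
    rw [← prod_Iic_mul_prod_Ioi f i]
    exact mul_dvd_mul_right (Finset.prod_dvd_prod_of_subset _ _ _ (Finset.Iic_subset_Iic.2 hji)) _
  · have h1 : ∏ l ∈ Finset.Iic j, f l = (∏ l ∈ Finset.Iic i, f l) * ∏ l ∈ Finset.Ioc i j, f l := by
      rw [← Finset.prod_union (Finset.disjoint_left.2 (by simp +contextual))]
      congr 1
      ext l
      simp only [Finset.mem_Iic, Finset.mem_union, Finset.mem_Ioc]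
      exact ⟨fun h => (le_or_gt l i).imp_right fun h' => ⟨h', h⟩,
        fun h => h.elim (fun h => h.trans hij.le) fun h => h.2⟩
    have h2 : ∏ l ∈ Finset.Ioi i, f l = (∏ l ∈ Finset.Ioc i j, f l) * ∏ l ∈ Finset.Ioi j, f l := by
      rw [← Finset.prod_union (Finset.disjoint_left.2 (by simp +contextual))]
      congr 1
      ext l
      simp only [Finset.mem_Ioi, Finset.mem_union, Finset.mem_Ioc]
      exact ⟨fun h => (le_or_gt l j).imp_left fun h' => ⟨h, h'⟩,
        fun h => h.elim (fun h => h.1) fun h => hij.trans h⟩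
    have hm : ∏ l ∈ Finset.Ioc i j, f l ≠ 0 := fun h0 =>
      hf (by rw [← prod_Iic_mul_prod_Ioi f j, h1, h0, mul_zero, zero_mul])
    rw [h1, h2, mul_comm (∏ l ∈ Finset.Iic i, f l), mul_assoc,
      mul_dvd_mul_iff_left hm] at hyj
    obtain ⟨d, rfl⟩ := dvd_of_dvd_mul_of_isReduced hf hred (by
      rw [← prod_Iic_mul_prod_Ioi f j, h1]
      exact mul_dvd_mul_right (dvd_mul_right _ _) _) hyj
    exact ⟨(Ideal.Quotient.mk _ d : QuotProd f) • partialQuotGen f j, by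
      rw [smul_smul, map_mul]; rfl⟩

/-- Multiplication by qᵢ embeds Sᵢ in R, so nonzerodivisors of R stay regular. -/
theorem smul_sumPartialQuot_eq_zero [IsDomain S] (hf : ∏ j, f j ≠ 0) {r : QuotProd f}
    (hr : r ∈ nonZeroDivisors (QuotProd f)) (y : sumPartialQuot f) (hy : r • y = 0) : y = 0 := by
  refine funext fun i => ?_
  have hyi : r • (y : ∀ j, partialQuot f j) i = 0 := congrFun hy i
  obtain ⟨c, hc⟩ := exists_smul_partialQuotGen f i ((y : ∀ j, partialQuot f j) i)
  change (y : ∀ j, partialQuot f j) i = 0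
  rw [← hc] at hyi ⊢
  rw [smul_smul, smul_partialQuotGen_eq_zero_iff] at hyi
  rw [smul_partialQuotGen_eq_zero_iff]
  obtain ⟨d, hd⟩ := hyi
  refine mul_finalProd_eq_zero hf ((mul_right_mem_nonZeroDivisors_eq_zero_iff hr).1 ?_)
  linear_combination finalProd f i * hd + d * initialProd_mul_finalProd f i

theorem finite_sumPartialQuot : Module.Finite (QuotProd f) (sumPartialQuot f) :=
  Module.Finite.of_surjective (sumPartialQuotCover f) sumPartialQuotCover_surjective

theorem InAdd.extOneVanishes_right [IsDomain S] (hf : ∏ j, f j ≠ 0)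
    {M X : ModuleCat.{u} (QuotProd f)} (hX : InAdd M X)
    (h : ExtOneVanishes (sumPartialQuot f) M) : ExtOneVanishes (sumPartialQuot f) X := by
  obtain ⟨m, a, p, hpa⟩ := hX
  rw [extOneVanishes_sumPartialQuot_iff hf] at h ⊢
  intro i x hx
  choose z hz using fun j => h i (a x j) (by
    rw [← Pi.smul_apply, ← map_smul, hx, map_zero, Pi.zero_apply])
  refine ⟨p z, ?_⟩
  rw [← map_smul, ← (funext hz : a x = initialProd f i • z)]
  exact (LinearMap.congr_fun hpa x).symm

theorem InAdd.isMaximalCohenMacaulay {R : Type u} [CommRing R] [IsLocalRing R]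
    (hdim : ringKrullDim R = 1) {M X : ModuleCat.{u} R} (hX : InAdd M X)
    (h : IsMaximalCohenMacaulay R M) : IsMaximalCohenMacaulay R X := by
  obtain ⟨m, a, p, hpa⟩ := hX
  rw [isMaximalCohenMacaulay_iff hdim] at h ⊢
  obtain ⟨hfin, r, hr, hrM⟩ := h
  have hpa' : ∀ x, p (a x) = x := LinearMap.congr_fun hpa
  refine ⟨Module.Finite.of_surjective p fun x => ⟨a x, hpa' x⟩, r, hr, fun x hx => ?_⟩
  rw [← hpa' x, show a x = 0 from funext fun j => hrM _ (by
    rw [← Pi.smul_apply, ← map_smul, hx, map_zero, Pi.zero_apply]), map_zero]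

/-- `S / (f₁ ⋯ fᵢ)` is self-dual over `S / (f₁ ⋯ fₙ)`. -/
theorem nonempty_partialQuot_equiv_dual [IsDomain S] (hf : ∏ j, f j ≠ 0) (i : Fin n) :
    Nonempty (partialQuot f i ≃ₗ[QuotProd f] Module.Dual (QuotProd f) (partialQuot f i)) := by
  -- A functional on Sᵢ is fixed by its value at 1, which pᵢ kills and which is thus a multiple of
  -- qᵢ; so θ generates the dual.
  obtain ⟨θ, hθ⟩ := exists_linearMap_partialQuot f i (x := finalProd f i)
    (initialProd_mul_finalProd f i)
  have hcθ : ∀ c : QuotProd f, c • θ = 0 ↔ c • partialQuotGen f i = 0 := by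
    intro c
    constructor
    · intro h
      rw [smul_partialQuotGen_eq_zero_iff]
      refine mul_finalProd_eq_zero hf ?_
      rw [← hθ]
      exact LinearMap.congr_fun h (partialQuotGen f i)
    · intro h
      refine linearMap_ext_of_span _ (span_partialQuotGen f i) fun _ => ?_
      rw [LinearMap.smul_apply, ← map_smul, h, map_zero, LinearMap.zero_apply]
  obtain ⟨Θ, hΘ⟩ := exists_linearMap_partialQuot f i (x := θ)
    ((hcθ _).2 ((smul_partialQuotGen_eq_zero_iff f i _).2 dvd_rfl))
  have hΘ' : ∀ c : QuotProd f, Θ (c • partialQuotGen f i) = c • θ := fun c => by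
    rw [map_smul, hΘ]
  refine ⟨LinearEquiv.ofBijective Θ ⟨?_, fun φ => ?_⟩⟩
  · rw [injective_iff_map_eq_zero]
    intro y hy
    obtain ⟨c, rfl⟩ := exists_smul_partialQuotGen f i y
    rw [hΘ'] at hy
    exact (hcθ c).1 hy
  · have h0 : φ (partialQuotGen f i) * initialProd f i = 0 := by
      rw [mul_comm, ← smul_eq_mul, ← map_smul,
        (smul_partialQuotGen_eq_zero_iff f i _).2 dvd_rfl, map_zero]
    obtain ⟨d, hd⟩ := mul_initialProd_eq_zero hf h0
    refine ⟨d • partialQuotGen f i, ?_⟩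
    rw [hΘ']
    refine linearMap_ext_of_span _ (span_partialQuotGen f i) fun _ => ?_
    rw [LinearMap.smul_apply, hθ, hd, smul_eq_mul, mul_comm]

theorem nonempty_sumPartialQuot_equiv_dual [IsDomain S] (hf : ∏ j, f j ≠ 0) :
    Nonempty (sumPartialQuot f ≃ₗ[QuotProd f] Module.Dual (QuotProd f) (sumPartialQuot f)) := by
  let e := fun i => (nonempty_partialQuot_equiv_dual hf i).some
  exact ⟨(LinearEquiv.piCongrRight e).trans (LinearMap.lsum (QuotProd f) (fun i => partialQuot f i)
    (QuotProd f))⟩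

end SumPartialQuot

/-! ### Duality on add M -/

section Dual

variable {R : Type u} [CommRing R]

theorem InAdd.dual {M X : ModuleCat.{u} R} (e : M ≃ₗ[R] Module.Dual R M) (hX : InAdd M X) :
    InAdd M (ModuleCat.of R (Module.Dual R X)) := by
  obtain ⟨m, a, p, hpa⟩ := hX
  let E : (Fin m → M) ≃ₗ[R] Module.Dual R (Fin m → M) :=
    (LinearEquiv.piCongrRight fun _ => e).trans (LinearMap.lsum R (fun _ : Fin m => M) R)
  refine ⟨m, E.symm.toLinearMap ∘ₗ p.dualMap, a.dualMap ∘ₗ E.toLinearMap, ?_⟩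
  refine LinearMap.ext fun φ => LinearMap.ext fun x => ?_
  have : p (a x) = x := LinearMap.congr_fun hpa x
  change (E (E.symm (p.dualMap φ))) (a x) = φ x
  rw [LinearEquiv.apply_symm_apply, LinearMap.dualMap_apply, this]

theorem InAdd.of_linearEquiv {M X Y : ModuleCat.{u} R} (e : X ≃ₗ[R] Y) (hX : InAdd M X) :
    InAdd M Y := by
  obtain ⟨m, a, p, hpa⟩ := hX
  refine ⟨m, a ∘ₗ e.symm.toLinearMap, e.toLinearMap ∘ₗ p, LinearMap.ext fun y => ?_⟩
  have : p (a (e.symm y)) = e.symm y := LinearMap.congr_fun hpa _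
  change e (p (a (e.symm y))) = y
  rw [this, LinearEquiv.apply_symm_apply]

end Dual

/-! ### From exactness to membership in add M -/

section Decomposition

variable {S : Type u} [CommRing S] {n : ℕ} {f : Fin n → S}

/-- Each cyclic summand gets its own copy of M and sits there in the coordinate `d j`. -/
theorem inAdd_of_generators {X : ModuleCat.{u} (QuotProd f)} {ι : Type u} [Fintype ι]
    (x : ι → X) (d : ι → Fin n) (hx : Submodule.span (QuotProd f) (Set.range x) = ⊤)
    (hrel : ∀ c : ι → S, ∑ j, (Ideal.Quotient.mk _ (c j) : QuotProd f) • x j = 0 ↔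
      ∀ j, ∏ l ∈ Finset.Iic (d j), f l ∣ c j) :
    InAdd (sumPartialQuot f) X := by
  classical
  let M : Type u := ∀ i, partialQuot f i
  let y : ι → ι → M := fun j => Pi.single j (Pi.single (d j) (partialQuotGen f (d j)))
  obtain ⟨a, ha⟩ := exists_linearMap_of_relations x hx y (by
    intro c hc
    choose c' hc' using fun j => Ideal.Quotient.mk_surjective (c j)
    obtain rfl : (fun j => Ideal.Quotient.mk _ (c' j)) = c := funext hc'
    refine Finset.sum_eq_zero fun j _ => ?_
    have := (mk_smul_partialQuotGen_eq_zero_iff f (d j) _).2 ((hrel c').1 hc j)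
    rw [← Pi.single_smul, ← Pi.single_smul, this, Pi.single_zero, Pi.single_zero])
  have hx0 : ∀ j, initialProd f (d j) • x j = 0 := by
    intro j
    have := (hrel (Pi.single j (∏ l ∈ Finset.Iic (d j), f l))).2 fun l => by
      by_cases h : l = j
      · subst h; simp
      · simp [h]
    rw [Finset.sum_eq_single j (fun l _ hl => by rw [Pi.single_eq_of_ne hl, map_zero, zero_smul])
      (fun h => absurd (Finset.mem_univ j) h), Pi.single_eq_same] at this
    exact this
  choose P hP using fun j => exists_linearMap_partialQuot f (d j) (hx0 j)
  let p : (ι → M) →ₗ[QuotProd f] X :=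
    LinearMap.lsum (QuotProd f) (fun _ : ι => M) (QuotProd f) fun j => P j ∘ₗ LinearMap.proj (d j)
  have hp : ∀ j, p (y j) = x j := by
    intro j
    refine (LinearMap.lsum_piSingle (R := QuotProd f) (φ := fun _ : ι => M) (QuotProd f) _ j _).trans ?_
    rw [LinearMap.comp_apply, LinearMap.proj_apply, Pi.single_eq_same, hP]
  let e : (ι → M) ≃ₗ[QuotProd f] (Fin (Fintype.card ι) → M) :=
    LinearEquiv.funCongrLeft (QuotProd f) M (Fintype.equivFin ι).symm
  refine ⟨Fintype.card ι, e.toLinearMap ∘ₗ a, p ∘ₗ e.symm.toLinearMap,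
    linearMap_ext_of_span x hx fun j => ?_⟩
  change p (e.symm (e (a (x j)))) = x j
  rw [LinearEquiv.symm_apply_apply, ha, hp]

theorem prod_take_ofFn_succ (i : Fin n) :
    ((List.ofFn f).take (i + 1)).prod = ∏ j ∈ Finset.Iic i, f j := by
  rw [List.prod_take_ofFn]
  refine Finset.prod_congr (Finset.ext fun j => ?_) fun _ _ => rfl
  rw [Finset.mem_filter_univ, Finset.mem_Iic, Fin.le_def, Nat.lt_succ_iff]

theorem prod_drop_ofFn_succ [IsDomain S] (hf : ∏ j, f j ≠ 0) (i : Fin n) :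
    ((List.ofFn f).drop (i + 1)).prod = ∏ j ∈ Finset.Ioi i, f j := by
  have h := List.prod_take_mul_prod_drop (List.ofFn f) (i + 1)
  rw [List.prod_ofFn, prod_take_ofFn_succ, ← prod_Iic_mul_prod_Ioi f i] at h
  rw [← prod_Iic_mul_prod_Ioi f i] at hf
  exact mul_left_cancel₀ (left_ne_zero_of_mul hf) h

theorem inAdd_of_exact [IsDomain S] [IsNoetherianRing S] [IsLocalRing S]
    [IsLocalRing (QuotProd f)] (hf : ∏ j, f j ≠ 0)
    (hred : IsReduced (S ⧸ Ideal.span {∏ j, f j}))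
    (hm : ∀ i, ∃ t, maximalIdeal S = Ideal.span {f i, t})
    (X : ModuleCat.{u} (QuotProd f)) (hfin : Module.Finite (QuotProd f) X) {r : QuotProd f}
    (hr : r ∈ maximalIdeal (QuotProd f)) (hrX : ∀ x : X, r • x = 0 → x = 0)
    (hX : ∀ (i : Fin n) (x : X), finalProd f i • x = 0 → ∃ x', x = initialProd f i • x') :
    InAdd (sumPartialQuot f) X := by
  let q : S →+* QuotProd f := Ideal.Quotient.mk _
  have hq : Function.Surjective q := Ideal.Quotient.mk_surjective
  let _ : Module S X := Module.compHom X q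
  have : IsScalarTower S (QuotProd f) X := ⟨fun s c x => by
    obtain ⟨c, rfl⟩ := hq c
    exact mul_smul (q s) (q c) x⟩
  have : Module.Finite S X := Module.Finite.trans (QuotProd f) X
  obtain ⟨s, rfl⟩ := hq r
  have hs : s ∈ maximalIdeal S := by
    rw [mem_maximalIdeal, mem_nonunits_iff] at hr ⊢
    exact fun h => hr (h.map q)
  obtain ⟨ι, _, x, d, hd, hspan, hrel⟩ := hasCyclicDecomposition (List.ofFn f)
    (fun g hg => by
      obtain ⟨i, rfl⟩ := (List.mem_ofFn' _ _).1 hg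
      exact hm i)
    (fun a b g h h' => dvd_of_dvd_mul_of_isReduced hf hred (by rwa [List.prod_ofFn] at h) h')
    X hs hrX
    (fun x => by
      have h0 : q (List.ofFn f).prod = 0 := by
        rw [List.prod_ofFn]
        exact Ideal.Quotient.eq_zero_iff_mem.2 (Ideal.mem_span_singleton_self _)
      change q (List.ofFn f).prod • x = 0
      rw [h0, zero_smul])
    (fun i x hx => by
      -- Cuts at 0 or beyond n are vacuous; a cut at j + 1 is the condition at the index j : `Fin
      -- n`, counted from 0.
      rcases Nat.eq_zero_or_pos i with rfl | hi
      · exact ⟨x, by simp⟩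
      rcases Nat.lt_or_ge n i with hin | hin
      · rw [List.drop_eq_nil_of_le (by simpa using hin.le), List.prod_nil, one_smul] at hx
        exact ⟨0, by rw [hx, smul_zero]⟩
      · obtain ⟨j, rfl⟩ : ∃ j : Fin n, i = j + 1 := ⟨⟨i - 1, by omega⟩, by simp; omega⟩
        rw [prod_drop_ofFn_succ hf] at hx
        rw [prod_take_ofFn_succ]
        exact hX j x hx)
  simp only [List.length_ofFn] at hd
  refine inAdd_of_generators x (fun j => ⟨d j - 1, by have := hd j; omega⟩) ?_ fun c => ?_
  · rw [eq_top_iff]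
    intro v _
    have hv : v ∈ Submodule.span S (Set.range x) := hspan ▸ Submodule.mem_top
    exact Submodule.span_le_restrictScalars S (QuotProd f) (Set.range x) hv
  · refine (hrel c).trans (forall_congr' fun j => ?_)
    rw [← prod_take_ofFn_succ]
    have : d j - 1 + 1 = d j := by have := hd j; omega
    simp only [this]

/-- The maps qᵢ : Sᵢ → R embed M in Rⁿ as the kernel of G = diag(pᵢ). A functional killed by qᵢ has
values in pᵢR, so it maps to the range of G; a lift to Rⁿ divides it by pᵢ. -/
theorem exact_dual_of_extOneVanishes [IsDomain S] (hf : ∏ j, f j ≠ 0)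
    (X : ModuleCat.{u} (QuotProd f)) (h : ExtOneVanishes X (sumPartialQuot f)) (i : Fin n)
    (φ : Module.Dual (QuotProd f) X) (hφ : finalProd f i • φ = 0) :
    ∃ ψ : Module.Dual (QuotProd f) X, φ = initialProd f i • ψ := by
  classical
  rw [extOneVanishes_iff_lift] at h
  let M : Type u := ∀ i, partialQuot f i
  let G : (Fin n → QuotProd f) →ₗ[QuotProd f] (Fin n → QuotProd f) :=
    LinearMap.pi fun i => initialProd f i • LinearMap.proj i
  have hG : ∀ c i, G c i = initialProd f i * c i := fun c i => rfl
  choose θ hθ using fun i => exists_linearMap_partialQuot f i (x := finalProd f i)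
    (initialProd_mul_finalProd f i)
  let a : M →ₗ[QuotProd f] (Fin n → QuotProd f) := LinearMap.pi fun i => θ i ∘ₗ LinearMap.proj i
  have ha : ∀ (c : Fin n → QuotProd f) i,
      a (fun i => c i • partialQuotGen f i) i = c i * finalProd f i := fun c i => by
    change θ i (c i • partialQuotGen f i) = _
    rw [map_smul, hθ, smul_eq_mul]
  have hsurj : ∀ y : M, ∃ c : Fin n → QuotProd f, (fun i => c i • partialQuotGen f i) = y :=
    fun y => by
      choose c hc using fun i => exists_smul_partialQuotGen f i (y i)
      exact ⟨c, funext hc⟩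
  obtain ⟨ψ, hψ⟩ := h (ModuleCat.of _ (Fin n → QuotProd f)) (ModuleCat.of _ (LinearMap.range G)) a
    G.rangeRestrict
    (by
      change Function.Injective a
      rw [injective_iff_map_eq_zero]
      intro y hy
      obtain ⟨c, rfl⟩ := hsurj y
      funext i
      refine (smul_partialQuotGen_eq_zero_iff f i _).2 (mul_finalProd_eq_zero hf ?_)
      rw [← ha]
      exact congrFun hy i)
    (by
      intro c
      constructor
      · intro hc
        have hc' : ∀ i, c i * initialProd f i = 0 := fun i => by
          rw [mul_comm, ← hG]
          exact congrFun (congrArg Subtype.val hc) i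
        choose b hb using fun i => mul_initialProd_eq_zero hf (hc' i)
        exact ⟨fun i => b i • partialQuotGen f i, funext fun i =>
          (ha b i).trans ((mul_comm _ _).trans (hb i).symm)⟩
      · rintro ⟨y, rfl⟩
        obtain ⟨b, rfl⟩ := hsurj y
        refine Subtype.ext (funext fun i => ?_)
        change initialProd f i * a (fun i => b i • partialQuotGen f i) i = 0
        rw [ha, mul_left_comm, initialProd_mul_finalProd, mul_zero])
    G.surjective_rangeRestrict
    (LinearMap.codRestrict _ (LinearMap.single _ (fun _ => QuotProd f) i ∘ₗ φ) (by
      intro x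
      have : φ x * finalProd f i = 0 := by
        rw [mul_comm]
        exact LinearMap.congr_fun hφ x
      obtain ⟨c, hc⟩ := mul_finalProd_eq_zero hf this
      refine ⟨Pi.single i c, funext fun j => ?_⟩
      rw [hG, LinearMap.comp_apply, LinearMap.single_apply]
      by_cases hj : j = i
      · subst hj
        rw [Pi.single_eq_same, Pi.single_eq_same, hc]
      · rw [Pi.single_eq_of_ne hj, Pi.single_eq_of_ne hj, mul_zero]))
  refine ⟨LinearMap.proj i ∘ₗ ψ, LinearMap.ext fun x => ?_⟩
  have := congrFun (congrArg Subtype.val (LinearMap.congr_fun hψ x)) i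
  refine Eq.trans ?_ this.symm
  exact (Pi.single_eq_same (M := fun _ : Fin n => QuotProd f) i (φ x)).symm

end Decomposition

theorem finite_dual (R : Type*) [CommRing R] [IsNoetherianRing R] (X : Type*) [AddCommGroup X]
    [Module R X] [Module.Finite R X] : Module.Finite R (Module.Dual R X) := by
  obtain ⟨m, x, hx⟩ := Module.Finite.exists_fin (R := R) (M := X)
  refine Module.Finite.of_injective (LinearMap.pi fun l => Module.Dual.eval R X (x l)) ?_
  intro φ ψ h
  exact linearMap_ext_of_span x hx fun l => congrFun h l

/-- Modules of depth one over a plane curve are reflexive, as soon as some smooth curve meets no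
component of the given one. -/
theorem bijective_eval_of_regular {S : Type u} [CommRing S] [IsDomain S] [IsNoetherianRing S]
    [IsLocalRing S] {n : ℕ} {f : Fin n → S} [IsLocalRing (QuotProd f)] (hf : ∏ j, f j ≠ 0) {t t' : S}
    (ht0 : t ≠ 0) (hm : maximalIdeal S = Ideal.span {t, t'}) (htt' : ∀ v, t ∣ t' * v → t ∣ v)
    (hft : ∀ i, maximalIdeal S = Ideal.span {f i, t})
    (X : Type u) [AddCommGroup X] [Module (QuotProd f) X] [Module.Finite (QuotProd f) X]
    {r : QuotProd f} (hr : r ∈ maximalIdeal (QuotProd f)) (hrX : ∀ x : X, r • x = 0 → x = 0) :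
    Function.Bijective (Module.Dual.eval (QuotProd f) X) := by
  let q : S →+* QuotProd f := Ideal.Quotient.mk _
  have hq : Function.Surjective q := Ideal.Quotient.mk_surjective
  let _ : Module S X := Module.compHom X q
  have : IsScalarTower S (QuotProd f) X := ⟨fun s c x => by
    obtain ⟨c, rfl⟩ := hq c
    exact mul_smul (q s) (q c) x⟩
  have : Module.Finite S X := Module.Finite.trans (QuotProd f) X
  obtain ⟨s, rfl⟩ := hq r
  have hs : s ∈ maximalIdeal S := by
    rw [mem_maximalIdeal, mem_nonunits_iff] at hr ⊢
    exact fun h => hr (h.map q)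
  have hX0 : ∀ x : X, (∏ j, f j) • x = 0 := fun x => by
    have h0 : q (∏ j, f j) = 0 :=
      Ideal.Quotient.eq_zero_iff_mem.2 (Ideal.mem_span_singleton_self _)
    change q (∏ j, f j) • x = 0
    rw [h0, zero_smul]
  have htX : ∀ x : X, t • x = 0 → x = 0 := by
    intro x hx
    -- Strip one branch at a time: what both fᵢ and t kill is killed by 𝔪, hence zero.
    have key : ∀ (A : Finset (Fin n)) (x : X), t • x = 0 → (∏ j ∈ A, f j) • x = 0 → x = 0 := by
      intro A
      induction A using Finset.induction_on with
      | empty => exact fun x _ h => by simpa using h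
      | insert i A hi ih =>
        intro x hx h
        rw [Finset.prod_insert hi, mul_smul] at h
        have ht : t • (∏ j ∈ A, f j) • x = 0 := by rw [smul_comm, hx, smul_zero]
        exact ih x hx (smul_eq_zero_of_span_pair (hft i) hs hrX h ht)
    exact key _ x hx (hX0 x)
  obtain ⟨m, τ, _, _, x, A, B, hx, hrel, hAB, hBA⟩ :=
    exists_matrixFactorization hm ht0 htt' X htX hX0
  refine bijective_eval_of_matrixFactorization hf x A B ?_ hrel hAB hBA
  rw [eq_top_iff]
  intro v _
  have hv : v ∈ Submodule.span S (Set.range x) := hx ▸ Submodule.mem_top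
  exact Submodule.span_le_restrictScalars S (QuotProd f) (Set.range x) hv

end CMCluster

/-! ### The main theorem -/

theorem mainTheorem2 {k : Type u} [Field k] [Infinite k] {n : ℕ}
    (f : Fin n → MvPowerSeries (Fin 2) k)
    (hirr : ∀ i, Irreducible (f i))
    (hmem : ∏ i, f i ∈ IsLocalRing.maximalIdeal (MvPowerSeries (Fin 2) k))
    (hred : IsReduced (MvPowerSeries (Fin 2) k ⧸ Ideal.span {∏ i, f i})) :
    haveI : IsLocalRing (CMCluster.QuotProd f) := CMCluster.isLocalRing_quotProd f hmem
    CMCluster.IsRigidObject (CMCluster.sumPartialQuot f) ∧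
      ((∀ i, f i ∉ IsLocalRing.maximalIdeal (MvPowerSeries (Fin 2) k) ^ 2) →
        CMCluster.IsClusterTilting (CMCluster.sumPartialQuot f)) := by
  have : IsLocalRing (CMCluster.QuotProd f) := CMCluster.isLocalRing_quotProd f hmem
  have := CMCluster.isDomain_mvPowerSeries (k := k) (Fin 2)
  have hf : ∏ i, f i ≠ 0 := Finset.prod_ne_zero_iff.2 fun i _ => (hirr i).ne_zero
  have hdim : ringKrullDim (CMCluster.QuotProd f) = 1 :=
    CMCluster.ringKrullDim_quotient_eq_one hf hmem
  obtain ⟨r, hr, hr0⟩ := CMCluster.exists_mem_maximalIdeal_nonZeroDivisors _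
    (CMCluster.maximalIdeal_quotient_ne_bot hmem)
  have hCM : CMCluster.IsMaximalCohenMacaulay (CMCluster.QuotProd f)
      (CMCluster.sumPartialQuot f) :=
    (CMCluster.isMaximalCohenMacaulay_iff hdim _).2 ⟨CMCluster.finite_sumPartialQuot, r, hr,
      CMCluster.smul_sumPartialQuot_eq_zero hf hr0⟩
  have hrigid := CMCluster.extOneVanishes_self hf hred
  refine ⟨⟨hCM, hrigid⟩, fun hf2 => ⟨hCM, ?_, ?_⟩⟩
  all_goals
    obtain ⟨t, t', ht0, hm, htt', hft⟩ := CMCluster.exists_transversal f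
      (fun i => (IsLocalRing.mem_maximalIdeal _).2 (hirr i).not_isUnit) hf2
    refine Set.ext fun X => ⟨fun hX => ⟨hX.isMaximalCohenMacaulay hdim hCM, ?_⟩,
      fun ⟨hX, hext⟩ => ?_⟩
  · exact hX.extOneVanishes_right hf hrigid
  · obtain ⟨hfin, s, hs, hsX⟩ := (CMCluster.isMaximalCohenMacaulay_iff hdim X).1 hX
    exact CMCluster.inAdd_of_exact hf hred (fun i => ⟨t, hft i⟩) X hfin hs hsX
      ((CMCluster.extOneVanishes_sumPartialQuot_iff hf X).1 hext)
  · exact hX.extOneVanishes_left hrigid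
  · obtain ⟨hfin, s, hs, hsX⟩ := (CMCluster.isMaximalCohenMacaulay_iff hdim X).1 hX
    obtain ⟨e⟩ := CMCluster.nonempty_sumPartialQuot_equiv_dual hf
    -- Functionals take values in R, so the nonzerodivisor r is regular on the dual.
    have hdual := CMCluster.inAdd_of_exact hf hred (fun i => ⟨t, hft i⟩)
      (ModuleCat.of _ (Module.Dual (CMCluster.QuotProd f) X)) (CMCluster.finite_dual _ _) hr
      (fun φ hφ => LinearMap.ext fun x =>
        (mul_left_mem_nonZeroDivisors_eq_zero_iff hr0).1 (LinearMap.congr_fun hφ x))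
      (CMCluster.exact_dual_of_extOneVanishes hf X hext)
    exact (hdual.dual e).of_linearEquiv (LinearEquiv.ofBijective
      (Module.Dual.eval (CMCluster.QuotProd f) X)
      (CMCluster.bijective_eval_of_regular hf ht0 hm htt' hft X hs hsX)).symm
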